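/- Let $W$ be the affine Weyl group of type $\widetilde A_2$, with simple reflections $s_0,s_1,s_2$ (indices are read modulo $3$; $(s_is_j)^3=1$ for $i\neq j$), Bruhat order $\le$ and identity $\mathrm{id}$. Let $\alpha_1,\alpha_2$ be simple roots of type $A_2$ in the Euclidean plane $E$, with $(\alpha_1,\alpha_1)=(\alpha_2,\alpha_2)=2$, $(\alpha_1,\alpha_2)=-1$, and let $\rho=\alpha_1+\alpha_2$. The group $W$ acts on $E$ by isometries: $s_1,s_2,s_0$ are the orthogonal reflections in the lines $(\alpha_1,v)=0$, $(\alpha_2,v)=0$, $(\rho,v)=-1$ respectively. Let $A_+=\{v\in E: -1<(\alpha,v)<0 \text{ for } \alpha=\alpha_1,\alpha_2,\alpha_1+\alpha_2\}$ be the fundamental alcove (an open triangle), and for $z\in W$ let $\operatorname{cen}(z)$ be the center (centroid) of the alcove $zA_+$. Let $W_f=\langle s_1,s_2\rangle$. Let $\delta,\sigma$ be the automorphisms of $W$ with $\delta(s_i)=s_{i+1}$ and $\sigma(s_i)=s_{-i}$. For $k\ge 1$ put $\mathbf x_k=s_1s_2s_3\cdots s_k$. For integers $m,n\ge 0$ put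 $$\theta(m,n)=s_1s_2\cdots s_{2m+1}s_{2m+2}s_{2m+1}s_{2m}\cdots s_{2m-2n+1}$$ (indices increase from $1$ to $2m+2$ and then decrease to $2m-2n+1$), and let $\theta^s(m,n)=\theta(m,n)t$, where $t\in\{s_0,s_1,s_2\}$ is the simple reflection with $\theta(m,n)<\theta(m,n)t$. Put $D=\{\theta(m,n),\theta^s(m,n): m,n\ge 0\}$. A bounded convex polygon is the convex hull of a finite subset of $E$ (points and segments are allowed); its vertex set is the minimal finite set of which it is the convex hull. For $V\subseteq W$ we also write $V$ for the set $\operatorname{cen}(V)$ of points. Then for every $y\in W$ there is a bounded convex polygon $C_y\subset E$ such that, for all $x\in W$, $$x\le y\iff \operatorname{cen}(x)\in C_y .$$ Moreover every $y\in W$ falls under at least one of the following cases, and $C_y$ can be chosen such that in each case under which $y$ falls (for each admissible choice of $i$, $g$ and $k$) its vertex set $V(C_y)$ is as listed: 1. if $y=\mathrm{id}$, then $V(C_y)=\{\mathrm{id}\}$; if $y=s_i$, then $V(C_y)=\{\mathrm{id},s_i\}$; 2. if $y\in\delta^i(D)$ with $i\ge 0$, then $C_y$ is a hexagon with vertex set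 $V(C_y)=\delta^i(W_f)\,y$; 3. if $y\in\delta^i(s_0D)$ with $i\ge 0$, then $C_y$ is a hexagon with vertex set $V(C_y)=\{y,\ s_iy,\ s_{1+i}s_iy,\ s_{2+i}s_iy,\ s_is_{1+i}s_iy,\ s_is_{2+i}s_iy\}$; 4. if $y=g(\mathbf x_k)$ with $k\ge 2$ and $g$ in the group $\langle\delta,\sigma\rangle$, then $C_y$ is a quadrilateral with vertex set $V(C_y)=g(\{\mathbf x_k,\ s_1\mathbf x_k,\ s_2s_1\mathbf x_k,\ s_1s_2s_1\mathbf x_k\})$. -/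

import Mathlib

/-! ### Bruhat order of a Coxeter system -/

namespace AffineA2

/-- Bruhat order: the reflexive transitive closure of the relation
`u → w` iff `w = u t` for a reflection `t` and `ℓ u < ℓ w`. -/
def BruhatLE {B G : Type*} [Group G] {M : CoxeterMatrix B} (cs : CoxeterSystem M G) :
    G → G → Prop :=
  Relation.ReflTransGen
    (fun u w : G => cs.IsReflection (u⁻¹ * w) ∧ cs.length u < cs.length w)

/-! ### The affine Weyl group of type `Ã₂` as a Coxeter group -/

/-- The Coxeter matrix of type `Ã₂`; the index set is `ZMod 3`, so that labels are read
modulo `3`. -/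
def coxeterMatrix : CoxeterMatrix (ZMod 3) where
  M := Matrix.of fun i j => if i = j then 1 else 3
  isSymm := by
    ext i j
    simp [Matrix.transpose_apply, eq_comm]
  diagonal := by simp
  off_diagonal := by
    intro i j h
    simp [h]

/-- The affine Weyl group `W` of type `Ã₂`. -/
abbrev W : Type := coxeterMatrix.Group

/-- The Coxeter system `(W, {s 0, s 1, s 2})`. -/
abbrev cs : CoxeterSystem coxeterMatrix W := coxeterMatrix.toCoxeterSystem

/-- The simple reflections; the index is read modulo `3`. -/
def s (i : ZMod 3) : W := cs.simple i

/-- The Bruhat order on `W`. -/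
def le (x y : W) : Prop := BruhatLE cs x y

/-- The strict Bruhat order on `W`. -/
def lt (x y : W) : Prop := le x y ∧ x ≠ y

/-- The finite Weyl group, generated by `s 1` and `s 2`. -/
def Wf : Subgroup W := Subgroup.closure {s 1, s 2}

theorem coxeterMatrix_apply (i j : ZMod 3) :
    coxeterMatrix i j = if i = j then 1 else 3 := rfl

/-- The endomorphism of `W` induced by a permutation of the simple reflections. -/
noncomputable def diagramHom (e : Equiv.Perm (ZMod 3)) : W →* W :=
  cs.lift ⟨fun i => s (e i), by
    intro i j
    have h : coxeterMatrix i j = coxeterMatrix (e i) (e j) := by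
      simp [coxeterMatrix_apply]
    rw [h]
    exact cs.simple_mul_simple_pow (e i) (e j)⟩

theorem diagramHom_s (e : Equiv.Perm (ZMod 3)) (i : ZMod 3) :
    diagramHom e (s i) = s (e i) :=
  cs.lift_apply_simple _ i

/-- The automorphism of `W` induced by a permutation of the simple reflections (every
permutation is a symmetry of the Dynkin diagram, which is a triangle). -/
noncomputable def diagramAut (e : Equiv.Perm (ZMod 3)) : MulAut W :=
  MonoidHom.toMulEquiv (diagramHom e) (diagramHom e.symm)
    (cs.ext_simple fun i => by
      change diagramHom e.symm (diagramHom e (s i)) = s i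
      rw [diagramHom_s, diagramHom_s, Equiv.symm_apply_apply])
    (cs.ext_simple fun i => by
      change diagramHom e (diagramHom e.symm (s i)) = s i
      rw [diagramHom_s, diagramHom_s, Equiv.apply_symm_apply])

/-- The automorphism `δ` of `W` with `δ (s i) = s (i + 1)`. -/
noncomputable def δ : MulAut W := diagramAut (Equiv.addRight 1)

/-- The automorphism `σ` of `W` that fixes `s 0` and exchanges `s 1` and `s 2`. -/
noncomputable def σ : MulAut W := diagramAut (Equiv.neg (ZMod 3))

theorem δ_s (i : ZMod 3) : δ (s i) = s (i + 1) := diagramHom_s _ i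

theorem σ_s (i : ZMod 3) : σ (s i) = s (-i) := diagramHom_s _ i

/-! ### The elements `x_k`, `θ(m, n)`, and the set `D` -/

/-- `x_k = s 1 * s 2 * s 3 * ⋯ * s k`. -/
def xElt (k : ℕ) : W :=
  ((List.range k).map fun j : ℕ => s ((j : ZMod 3) + 1)).prod

/-- `θ(m, n) = s 1 * s 2 * ⋯ * s (2m+1) * s (2m+2) * s (2m+1) * ⋯ * s (2m-2n+1)`: the indices
increase from `1` to `2m+2` and then decrease from `2m+1` to `2m-2n+1`. -/
def theta (m n : ℕ) : W :=
  xElt (2 * m + 2) *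
    ((List.range (2 * n + 1)).map fun j : ℕ => s ((2 * m + 1 : ZMod 3) - (j : ZMod 3))).prod

/-- The set `D` of the elements `θ(m, n)` and `θˢ(m, n) = θ(m, n) * t`, where `t` is the simple
reflection with `θ(m, n) < θ(m, n) * t`. -/
def D : Set W :=
  {y | ∃ m n : ℕ, y = theta m n ∨ ∃ i : ZMod 3, lt (theta m n) (theta m n * s i) ∧
    y = theta m n * s i}

/-! ### The Euclidean plane, the roots, and the action of `W` by affine reflections -/

/-- The real Euclidean plane. -/
abbrev E : Type := EuclideanSpace ℝ (Fin 2)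

/-- The simple root `α₁`. -/
noncomputable def α₁ : E := !₂[√2, 0]

/-- The simple root `α₂`; it has the same length as `α₁`, and the angle between `α₁` and `α₂` is
`2π/3`. -/
noncomputable def α₂ : E := !₂[-√2 / 2, √6 / 2]

/-- The highest root `ρ = α₁ + α₂ = ϖ₁ + ϖ₂`. -/
noncomputable def ρ : E := α₁ + α₂

/-- The fundamental weight `ϖ₁`. -/
noncomputable def ϖ₁ : E := (2 / 3 : ℝ) • α₁ + (1 / 3 : ℝ) • α₂

/-- The fundamental weight `ϖ₂`. -/
noncomputable def ϖ₂ : E := (1 / 3 : ℝ) • α₁ + (2 / 3 : ℝ) • α₂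

theorem inner_E (v w : E) : inner ℝ v w = v 0 * w 0 + v 1 * w 1 := by
  rw [PiLp.inner_apply, Fin.sum_univ_two]
  simp [mul_comm]

theorem inner_α₁ (v : E) : inner ℝ α₁ v = √2 * v 0 := by
  rw [inner_E]; simp [α₁]

theorem inner_α₂ (v : E) : inner ℝ α₂ v = -√2 / 2 * v 0 + √6 / 2 * v 1 := by
  rw [inner_E]; simp [α₂]

theorem inner_α₁_α₁ : inner ℝ α₁ α₁ = (2 : ℝ) := by
  rw [inner_α₁]; simp [α₁]

theorem inner_α₂_α₂ : inner ℝ α₂ α₂ = (2 : ℝ) := by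
  have h2 : √2 * √2 = (2 : ℝ) := Real.mul_self_sqrt (by norm_num)
  have h6 : √6 * √6 = (6 : ℝ) := Real.mul_self_sqrt (by norm_num)
  rw [inner_α₂]; simp [α₂]
  linear_combination h2 / 4 + h6 / 4

theorem inner_α₁_α₂ : inner ℝ α₁ α₂ = (-1 : ℝ) := by
  have h2 : √2 * √2 = (2 : ℝ) := Real.mul_self_sqrt (by norm_num)
  rw [inner_α₁]; simp [α₂]
  linear_combination -h2 / 2

/-- For a vector `a` with `(a, a) = 2` this is the orthogonal reflection through the affine line
`{v | (a, v) = k}`: the reflection in `aᗮ` followed by the translation by `k • a`. -/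
noncomputable def affineReflection (a : E) (k : ℝ) : E ≃ᵃⁱ[ℝ] E :=
  ((ℝ ∙ a)ᗮ.reflection).toAffineIsometryEquiv.trans (AffineIsometryEquiv.constVAdd ℝ E (k • a))

theorem affineReflection_apply (a : E) (k : ℝ) (ha : inner ℝ a a = (2 : ℝ)) (v : E) :
    affineReflection a k v = v - (inner ℝ a v - k) • a := by
  have hn : ‖a‖ ^ 2 = 2 := by rw [← ha, real_inner_self_eq_norm_sq]
  change k • a + (ℝ ∙ a)ᗮ.reflection v = _
  rw [Submodule.reflection_orthogonal_apply, Submodule.reflection_singleton_apply]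
  simp only [RCLike.ofReal_real_eq_id, id_eq, hn]
  module

/-- The reflections of the plane by which the simple reflections act: `s 1` and `s 2` act by the
reflections through `(α₁, v) = 0` and `(α₂, v) = 0`, and `s 0` acts by the reflection through
`(ρ, v) = -1`. -/
noncomputable def simpleReflection (i : ZMod 3) : E ≃ᵃⁱ[ℝ] E :=
  if i = 1 then affineReflection α₁ 0
  else if i = 2 then affineReflection α₂ 0
  else affineReflection ρ (-1)

theorem affineReflection_mul_self (a : E) (k : ℝ) (ha : inner ℝ a a = (2 : ℝ)) :
    affineReflection a k * affineReflection a k = 1 := by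
  ext1 v
  change affineReflection a k (affineReflection a k v) = v
  simp only [affineReflection_apply _ _ ha, inner_sub_right, real_inner_smul_right, ha]
  module

theorem affineReflection_braid (a b : E) (k l e : ℝ) (ha : inner ℝ a a = (2 : ℝ))
    (hb : inner ℝ b b = (2 : ℝ)) (hab : inner ℝ a b = e) (he : e * e = 1) :
    (affineReflection a k * affineReflection b l) ^ 3 = 1 := by
  have hba : inner ℝ b a = e := by rw [real_inner_comm, hab]
  ext1 v
  change affineReflection a k (affineReflection b l (affineReflection a k (affineReflection b l
    (affineReflection a k (affineReflection b l v))))) = v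
  simp only [affineReflection_apply _ _ ha, affineReflection_apply _ _ hb, inner_sub_right,
    real_inner_smul_right, ha, hb, hab, hba]
  have h3 : e ^ 2 = 1 := by rw [sq, he]
  match_scalars <;> grobner

/-- The action of `W` on the plane by affine isometries. -/
noncomputable def action : W →* (E ≃ᵃⁱ[ℝ] E) :=
  cs.lift ⟨simpleReflection, by
    have h1 := inner_α₁_α₁
    have h2 := inner_α₂_α₂
    have h12 := inner_α₁_α₂
    have h21 : inner ℝ α₂ α₁ = (-1 : ℝ) := by rw [real_inner_comm, h12]
    have h0 : inner ℝ ρ ρ = (2 : ℝ) := by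
      simp only [ρ, inner_add_left, inner_add_right, h1, h2, h12, h21]; norm_num
    have h01 : inner ℝ ρ α₁ = (1 : ℝ) := by
      simp only [ρ, inner_add_left, h1, h21]; norm_num
    have h02 : inner ℝ ρ α₂ = (1 : ℝ) := by
      simp only [ρ, inner_add_left, h2, h12]; norm_num
    have h10 : inner ℝ α₁ ρ = (1 : ℝ) := by rw [real_inner_comm, h01]
    have h20 : inner ℝ α₂ ρ = (1 : ℝ) := by rw [real_inner_comm, h02]
    have e0 : simpleReflection 0 = affineReflection ρ (-1) := rfl
    have e1 : simpleReflection 1 = affineReflection α₁ 0 := rfl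
    have e2 : simpleReflection 2 = affineReflection α₂ 0 := rfl
    intro i j
    rw [coxeterMatrix_apply]
    have key : ∀ i : ZMod 3, i = 0 ∨ i = 1 ∨ i = 2 := by decide
    rcases key i with rfl | rfl | rfl <;> rcases key j with rfl | rfl | rfl <;>
      simp only [e0, e1, e2]
    · exact affineReflection_mul_self _ _ h0
    · exact affineReflection_braid _ _ _ _ _ h0 h1 h01 (by norm_num)
    · exact affineReflection_braid _ _ _ _ _ h0 h2 h02 (by norm_num)
    · exact affineReflection_braid _ _ _ _ _ h1 h0 h10 (by norm_num)
    · exact affineReflection_mul_self _ _ h1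
    · exact affineReflection_braid _ _ _ _ _ h1 h2 h12 (by norm_num)
    · exact affineReflection_braid _ _ _ _ _ h2 h0 h20 (by norm_num)
    · exact affineReflection_braid _ _ _ _ _ h2 h1 h21 (by norm_num)
    · exact affineReflection_mul_self _ _ h2⟩

theorem action_s (i : ZMod 3) : action (s i) = simpleReflection i :=
  cs.lift_apply_simple _ i

/-! ### Alcoves and their centers -/

/-- The fundamental alcove `A₊ = {v | -1 < (α, v) < 0 for all positive roots α}`. -/
def fundamentalAlcove : Set E :=
  {v | ∀ α ∈ ({α₁, α₂, α₁ + α₂} : Set E), (-1 : ℝ) < inner ℝ α v ∧ inner ℝ α v < (0 : ℝ)}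

/-- The alcove of `z`, namely `z A₊`. -/
def alcove (z : W) : Set E := action z '' fundamentalAlcove

/-- The three vertices of the fundamental alcove. -/
noncomputable def fundamentalVertex : Fin 3 → E := ![0, -ϖ₁, -ϖ₂]

/-- The three vertices of the alcove of `z`. -/
noncomputable def alcoveVertex (z : W) (j : Fin 3) : E := action z (fundamentalVertex j)

/-- The center of the alcove of `z`: the centroid of its vertices. -/
noncomputable def cen (z : W) : E := Finset.univ.centroid ℝ (alcoveVertex z)

/-- The fundamental alcove is the open triangle with vertices `0`, `-ϖ₁`, `-ϖ₂`. -/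
theorem mem_fundamentalAlcove_iff (v : E) :
    v ∈ fundamentalAlcove ↔ ∃ t : Fin 3 → ℝ, (∀ j, 0 < t j) ∧ ∑ j, t j = 1 ∧
      v = ∑ j, t j • fundamentalVertex j := by
  have h1 := inner_α₁_α₁
  have h2 := inner_α₂_α₂
  have h12 := inner_α₁_α₂
  have h21 : inner ℝ α₂ α₁ = (-1 : ℝ) := by rw [real_inner_comm, h12]
  simp only [Fin.sum_univ_three, Fin.forall_fin_succ, fundamentalVertex]
  constructor
  · intro h
    have a1 := h α₁ (by simp)
    have a2 := h α₂ (by simp)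
    have a3 := h (α₁ + α₂) (by simp)
    rw [inner_add_left] at a3
    refine ⟨![1 + inner ℝ α₁ v + inner ℝ α₂ v, -inner ℝ α₁ v, -inner ℝ α₂ v], ?_, ?_, ?_⟩
    · simp
      refine ⟨by linarith, a1.2, a2.2⟩
    · simp
      ring
    · have q2 : √2 * √2 = (2 : ℝ) := Real.mul_self_sqrt (by norm_num)
      have q6 : √6 * √6 = (6 : ℝ) := Real.mul_self_sqrt (by norm_num)
      ext i
      rw [inner_α₁, inner_α₂]
      fin_cases i <;> simp [ϖ₁, ϖ₂, α₁, α₂]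
      · linear_combination -(v 0) / 2 * q2
      · linear_combination -(v 1) / 6 * q6
  · rintro ⟨t, ht, hs, rfl⟩
    have n1 : ‖α₁‖ ^ 2 = 2 := by rw [← h1, real_inner_self_eq_norm_sq]
    have n2 : ‖α₂‖ ^ 2 = 2 := by rw [← h2, real_inner_self_eq_norm_sq]
    simp at ht
    have i1 : inner ℝ α₁ (t 0 • (![0, -ϖ₁, -ϖ₂] : Fin 3 → E) 0 + t 1 • (![0, -ϖ₁, -ϖ₂] : Fin 3 → E) 1
        + t 2 • (![0, -ϖ₁, -ϖ₂] : Fin 3 → E) 2) = - t 1 := by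
      simp [ϖ₁, ϖ₂, inner_add_right, real_inner_smul_right, h12]
      linear_combination -(2 * t 1 + t 2) / 3 * n1
    have i2 : inner ℝ α₂ (t 0 • (![0, -ϖ₁, -ϖ₂] : Fin 3 → E) 0 + t 1 • (![0, -ϖ₁, -ϖ₂] : Fin 3 → E) 1
        + t 2 • (![0, -ϖ₁, -ϖ₂] : Fin 3 → E) 2) = - t 2 := by
      simp [ϖ₁, ϖ₂, inner_add_right, real_inner_smul_right, h21]
      linear_combination -(t 1 + 2 * t 2) / 3 * n2
    obtain ⟨p0, p1, p2⟩ := ht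
    rintro α (rfl | rfl | rfl)
    · rw [i1]; constructor <;> linarith
    · rw [i2]; constructor <;> linarith
    · rw [inner_add_left, i1, i2]; constructor <;> linarith

/-! ### Convex polygons -/

/-- `V` is the vertex set of the bounded convex polygon `P`: it is a minimal finite set whose convex
hull is `P`. -/
def IsVertexSet (V P : Set E) : Prop :=
  Minimal (fun A : Set E => A.Finite ∧ convexHull ℝ A = P) V

end AffineA2

open AffineA2

/-! In the coordinates `coord`, alcove centers become integral points `pt z`, and the length of `z`
is the number `sep (pt z)` of reflection lines separating its alcove from the fundamental one
(`length_eq_sep`). Since the reflection in each of these lines comes from `W` (`realized_refl`), the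
Bruhat order is plane geometry: it is generated by reflecting points across lines, away from the
fundamental alcove.

A hexagon, given by bounds on `a`, `b` and `a - b`, is then the lower interval of `y` as soon as two
conditions hold (`Hexagon.le_iff_mem`). It is stable under reflections towards the fundamental
alcove, which follows from inequalities between the bounds (`Hexagon.Balanced.mem_of_refl_mem`) and
puts everything below `y` inside. And `y` is its only regular point from which no upward reflection
stays inside, so that every alcove center in it climbs to `y`. Points, segments and quadrilaterals
are hexagons with coinciding vertices, so one argument serves all cases.

The lines bounding the fundamental alcove and their parallels through its vertices cut out three
strips, whose complement consists of six cones. Up to rotation the cones are the dominant chamber,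
which is `D` (`mem_D_iff`), and its image under `s 0`; up to diagram automorphisms the strips
consist of the `xElt k`, with the identity and `s 1` for `k = 0, 1`. As diagram automorphisms carry
hexagons to hexagons (`Describes.map`), five families of hexagons suffice.

Finally, a tight hexagon is the convex hull of its vertices and these are extreme points
(`Hexagon.convexHull_vertices`, `Hexagon.vertices_subset_extremePoints`). Hence the vertex set
depends on `y` alone (`Describes.unique`), and all cases that apply to the same `y` agree. -/

namespace AffineA2

/-! ### The action of `W` on the lattice points

The center of an alcove is `(a / 3) • α₁ + (b / 3) • α₂` with integers `a`, `b` whose sum is not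
divisible by `3`. -/

/-- The reflection through the line `(α, v) = k`, with `α = α₁, α₂, ρ` for `d = 1, 2, 0`, in the
coordinates `(a, b)`. -/
def refl (d : ZMod 3) (k : ℤ) (P : ℤ × ℤ) : ℤ × ℤ :=
  if d = 1 then (P.2 - P.1 + 3 * k, P.2)
  else if d = 2 then (P.1, P.1 - P.2 + 3 * k)
  else (-P.2 + 3 * k, -P.1 + 3 * k)

theorem refl_one (k a b : ℤ) : refl 1 k (a, b) = (b - a + 3 * k, b) := rfl

theorem refl_two (k a b : ℤ) : refl 2 k (a, b) = (a, a - b + 3 * k) := rfl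

theorem refl_zero (k a b : ℤ) : refl 0 k (a, b) = (-b + 3 * k, -a + 3 * k) := rfl

/-- The level of the wall of the fundamental alcove of type `i`. -/
def wallLevel (i : ZMod 3) : ℤ := if i = 0 then -1 else 0

theorem wallLevel_zero : wallLevel 0 = -1 := rfl

theorem wallLevel_one : wallLevel 1 = 0 := rfl

theorem wallLevel_two : wallLevel 2 = 0 := rfl

/-- The action of the simple reflections on the lattice points. -/
def gen (i : ZMod 3) : ℤ × ℤ → ℤ × ℤ := refl i (wallLevel i)

theorem gen_zero (a b : ℤ) : gen 0 (a, b) = (-b - 3, -a - 3) := rfl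

theorem gen_one (a b : ℤ) : gen 1 (a, b) = (b - a, b) := by
  simp [gen, refl_one, wallLevel_one]

theorem gen_two (a b : ℤ) : gen 2 (a, b) = (a, a - b) := by
  simp [gen, refl_two, wallLevel_two]

theorem zmod_three_cases (i : ZMod 3) : i = 0 ∨ i = 1 ∨ i = 2 := by
  revert i; decide

theorem gen_gen (i : ZMod 3) (P : ℤ × ℤ) : gen i (gen i P) = P := by
  obtain ⟨a, b⟩ := P
  rcases zmod_three_cases i with rfl | rfl | rfl <;>
    simp only [gen_zero, gen_one, gen_two, Prod.mk.injEq, and_true, true_and] <;> omega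

theorem gen_braid {i j : ZMod 3} (h : i ≠ j) (P : ℤ × ℤ) :
    gen i (gen j (gen i P)) = gen j (gen i (gen j P)) := by
  obtain ⟨a, b⟩ := P
  rcases zmod_three_cases i with rfl | rfl | rfl <;>
    rcases zmod_three_cases j with rfl | rfl | rfl <;>
    first
    | exact absurd rfl h
    | simp only [gen_zero, gen_one, gen_two, Prod.mk.injEq]; omega

/-- The action of `W` on the lattice points. -/
def latticeAction : W →* Function.End (ℤ × ℤ) :=
  cs.lift ⟨gen, by
    intro i j
    rw [coxeterMatrix_apply]
    split_ifs with h
    · subst h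
      funext P
      exact gen_gen i P
    · funext P
      change gen i (gen j (gen i (gen j (gen i (gen j P))))) = P
      rw [gen_braid h, gen_gen, gen_gen, gen_gen]⟩

/-- The coordinates of the center of the alcove of `z`. -/
def pt (z : W) : ℤ × ℤ := latticeAction z (-1, -1)

theorem pt_one : pt 1 = (-1, -1) := by
  rw [pt, map_one]; rfl

theorem pt_s_mul (i : ZMod 3) (z : W) : pt (s i * z) = gen i (pt z) := by
  have h : latticeAction (s i) = gen i := cs.lift_apply_simple _ i
  rw [pt, map_mul, h]; rfl

theorem s_mul_self (i : ZMod 3) : s i * s i = 1 := cs.simple_mul_simple_self i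

theorem s_mul_s_mul (i : ZMod 3) (z : W) : s i * (s i * z) = z := by
  rw [← mul_assoc, s_mul_self, one_mul]

theorem s_inv (i : ZMod 3) : (s i)⁻¹ = s i := cs.inv_simple i

theorem s_braid {i j : ZMod 3} (h : i ≠ j) : s i * s j * s i = s j * s i * s j := by
  have h3 : (s i * s j) ^ 3 = 1 := by
    have := cs.simple_mul_simple_pow i j
    rwa [coxeterMatrix_apply, if_neg h] at this
  have h4 : s i * s j * s i * (s j * s i * s j) = 1 := by
    rw [← h3]; simp only [pow_succ, pow_zero, one_mul, mul_assoc]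
  rw [mul_eq_one_iff_eq_inv] at h4
  rw [h4]
  simp only [mul_inv_rev, s_inv, mul_assoc]

theorem induction_left {p : W → Prop} (w : W) (one : p 1)
    (mul : ∀ (i : ZMod 3) (z : W), p z → p (s i * z)) : p w :=
  cs.simple_induction_left w one fun z i => mul i z

/-- The lattice point lies on no reflection line. -/
def Regular (P : ℤ × ℤ) : Prop := (P.1 + P.2) % 3 ≠ 0

theorem Regular.refl {P : ℤ × ℤ} (h : Regular P) (d : ZMod 3) (k : ℤ) :
    Regular (refl d k P) := by
  obtain ⟨a, b⟩ := P
  rcases zmod_three_cases d with rfl | rfl | rfl <;>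
    simp only [Regular, refl_zero, refl_one, refl_two] at * <;> omega

theorem Regular.gen {P : ℤ × ℤ} (h : Regular P) (i : ZMod 3) : Regular (gen i P) :=
  h.refl i _

theorem regular_pt (z : W) : Regular (pt z) := by
  induction z using induction_left with
  | one => rw [pt_one]; simp [Regular]
  | mul i z h => rw [pt_s_mul]; exact h.gen i

/-! ### The number of separating lines -/

/-- The number of reflection lines that separate the point from the fundamental alcove. -/
def sep (P : ℤ × ℤ) : ℕ :=
  ((2 * P.1 - P.2) / 3 + 1).natAbs + ((2 * P.2 - P.1) / 3 + 1).natAbs +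
    ((P.1 + P.2) / 3 + 1).natAbs

/-- Three times the value on the point of the root with label `d`. -/
def rootVal (d : ZMod 3) (P : ℤ × ℤ) : ℤ :=
  if d = 1 then 2 * P.1 - P.2 else if d = 2 then 2 * P.2 - P.1 else P.1 + P.2

theorem rootVal_zero (a b : ℤ) : rootVal 0 (a, b) = a + b := rfl

theorem rootVal_one (a b : ℤ) : rootVal 1 (a, b) = 2 * a - b := rfl

theorem rootVal_two (a b : ℤ) : rootVal 2 (a, b) = 2 * b - a := rfl

/-- The point is on the same side of the line as the fundamental alcove. -/
def Near (d : ZMod 3) (k : ℤ) (P : ℤ × ℤ) : Prop :=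
  (rootVal d P < 3 * k ∧ 0 ≤ k) ∨ (3 * k < rootVal d P ∧ k ≤ -1)

/-- Here `i` and `j` are the integer parts of the values of `α₁` and `α₂`. The alternative is the
orientation of the alcove: the integer part of the value of `ρ` is `i + j` or `i + j + 1`. This form
removes the divisions from `sep`. -/
theorem Regular.exists_param {P : ℤ × ℤ} (hP : Regular P) :
    ∃ i j : ℤ, P = (2 * i + j + 1, i + 2 * j + 1) ∨ P = (2 * i + j + 2, i + 2 * j + 2) := by
  obtain ⟨a, b⟩ := P
  simp only [Regular] at hP
  obtain h | h : (a + b) % 3 = 2 ∨ (a + b) % 3 = 1 := by omega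
  · refine ⟨(2 * a - b - 1) / 3, (2 * b - a - 1) / 3, Or.inl ?_⟩
    rw [Prod.mk.injEq]; omega
  · refine ⟨(2 * a - b - 2) / 3, (2 * b - a - 2) / 3, Or.inr ?_⟩
    rw [Prod.mk.injEq]; omega

theorem sep_param_one (i j : ℤ) : sep (2 * i + j + 1, i + 2 * j + 1) =
    (i + 1).natAbs + (j + 1).natAbs + (i + j + 1).natAbs := by
  simp only [sep]; omega

theorem sep_param_two (i j : ℤ) : sep (2 * i + j + 2, i + 2 * j + 2) =
    (i + 1).natAbs + (j + 1).natAbs + (i + j + 2).natAbs := by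
  simp only [sep]; omega

theorem refl_zero_param_one (k i j : ℤ) : refl 0 k (2 * i + j + 1, i + 2 * j + 1) =
    (2 * (k - j - 1) + (k - i - 1) + 2, (k - j - 1) + 2 * (k - i - 1) + 2) := by
  rw [refl_zero, Prod.mk.injEq]; omega

theorem refl_zero_param_two (k i j : ℤ) : refl 0 k (2 * i + j + 2, i + 2 * j + 2) =
    (2 * (k - j - 1) + (k - i - 1) + 1, (k - j - 1) + 2 * (k - i - 1) + 1) := by
  rw [refl_zero, Prod.mk.injEq]; omega

theorem refl_one_param_one (k i j : ℤ) : refl 1 k (2 * i + j + 1, i + 2 * j + 1) =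
    (2 * (2 * k - i - 1) + (i + j - k) + 2, (2 * k - i - 1) + 2 * (i + j - k) + 2) := by
  rw [refl_one, Prod.mk.injEq]; omega

theorem refl_one_param_two (k i j : ℤ) : refl 1 k (2 * i + j + 2, i + 2 * j + 2) =
    (2 * (2 * k - i - 1) + (i + j - k + 1) + 1, (2 * k - i - 1) + 2 * (i + j - k + 1) + 1) := by
  rw [refl_one, Prod.mk.injEq]; omega

theorem refl_two_param_one (k i j : ℤ) : refl 2 k (2 * i + j + 1, i + 2 * j + 1) =
    (2 * (i + j - k) + (2 * k - j - 1) + 2, (i + j - k) + 2 * (2 * k - j - 1) + 2) := by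
  rw [refl_two, Prod.mk.injEq]; omega

theorem refl_two_param_two (k i j : ℤ) : refl 2 k (2 * i + j + 2, i + 2 * j + 2) =
    (2 * (i + j - k + 1) + (2 * k - j - 1) + 1, (i + j - k + 1) + 2 * (2 * k - j - 1) + 1) := by
  rw [refl_two, Prod.mk.injEq]; omega

theorem sep_lt_sep_refl {P : ℤ × ℤ} (hP : Regular P) {d : ZMod 3} {k : ℤ} (h : Near d k P) :
    sep P < sep (refl d k P) := by
  obtain ⟨i, j, rfl | rfl⟩ := hP.exists_param <;>
    rcases zmod_three_cases d with rfl | rfl | rfl <;>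
    simp only [Near, rootVal_zero, rootVal_one, rootVal_two] at h <;>
    simp only [refl_zero_param_one, refl_zero_param_two, refl_one_param_one, refl_one_param_two,
      refl_two_param_one, refl_two_param_two, sep_param_one, sep_param_two] <;>
    omega

theorem refl_refl (d : ZMod 3) (k : ℤ) (P : ℤ × ℤ) : refl d k (refl d k P) = P := by
  obtain ⟨a, b⟩ := P
  rcases zmod_three_cases d with rfl | rfl | rfl <;>
    simp only [refl_zero, refl_one, refl_two, Prod.mk.injEq, and_true, true_and] <;> omega

/-- A regular point is not on the line, so it and its mirror image are on opposite sides. -/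
theorem near_or_near_refl {P : ℤ × ℤ} (hP : Regular P) (d : ZMod 3) (k : ℤ) :
    Near d k P ∨ Near d k (refl d k P) := by
  obtain ⟨a, b⟩ := P
  rcases zmod_three_cases d with rfl | rfl | rfl <;>
    simp only [Near, Regular, rootVal_zero, rootVal_one, rootVal_two, refl_zero, refl_one,
      refl_two] at * <;> omega

theorem sep_lt_sep_refl_iff {P : ℤ × ℤ} (hP : Regular P) {d : ZMod 3} {k : ℤ} :
    sep P < sep (refl d k P) ↔ Near d k P := by
  refine ⟨fun h => ?_, sep_lt_sep_refl hP⟩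
  refine (near_or_near_refl hP d k).resolve_right fun h' => ?_
  have := sep_lt_sep_refl (hP.refl d k) h'
  rw [refl_refl] at this
  omega

theorem sep_refl_lt_sep_iff {P : ℤ × ℤ} (hP : Regular P) {d : ZMod 3} {k : ℤ} :
    sep (refl d k P) < sep P ↔ Near d k (refl d k P) := by
  rw [← sep_lt_sep_refl_iff (hP.refl d k), refl_refl]

theorem sep_gen_le {P : ℤ × ℤ} (hP : Regular P) (i : ZMod 3) : sep (gen i P) ≤ sep P + 1 := by
  obtain ⟨m, n, rfl | rfl⟩ := hP.exists_param <;>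
    rcases zmod_three_cases i with rfl | rfl | rfl <;>
    simp only [gen, wallLevel_zero, wallLevel_one, wallLevel_two, refl_zero_param_one,
      refl_zero_param_two, refl_one_param_one, refl_one_param_two, refl_two_param_one,
      refl_two_param_two, sep_param_one, sep_param_two] <;>
    omega

theorem sep_gen_lt_iff {P : ℤ × ℤ} (hP : Regular P) (i : ZMod 3) :
    sep (gen i P) < sep P ↔ Near i (wallLevel i) (gen i P) :=
  sep_refl_lt_sep_iff hP

theorem eq_base_of_not_descent {P : ℤ × ℤ} (hP : Regular P)
    (h : ∀ i, ¬ sep (gen i P) < sep P) : P = (-1, -1) := by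
  have h0 := h 0
  have h1 := h 1
  have h2 := h 2
  rw [sep_gen_lt_iff hP] at h0 h1 h2
  obtain ⟨a, b⟩ := P
  simp only [Near, Regular, gen_zero, gen_one, gen_two, rootVal_zero, rootVal_one, rootVal_two,
    wallLevel_zero, wallLevel_one, wallLevel_two, Prod.mk.injEq] at *
  omega

/-- If two generators both descend from `P`, then `P` is the farthest point of its orbit under the
dihedral group they generate, and the whole braid word descends. This is the confluence behind
`elt_eq_of_descent`. -/
theorem descent_chain {P : ℤ × ℤ} (hP : Regular P) {i j : ZMod 3} (hij : i ≠ j)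
    (hi : sep (gen i P) < sep P) (hj : sep (gen j P) < sep P) :
    sep (gen j (gen i P)) < sep (gen i P) ∧
      sep (gen i (gen j (gen i P))) < sep (gen j (gen i P)) := by
  rw [sep_gen_lt_iff hP] at hi hj
  rw [sep_gen_lt_iff (hP.gen i), sep_gen_lt_iff ((hP.gen i).gen j)]
  obtain ⟨a, b⟩ := P
  rcases zmod_three_cases i with rfl | rfl | rfl <;>
    rcases zmod_three_cases j with rfl | rfl | rfl <;>
    first
    | exact absurd rfl hij
    | simp only [Near, Regular, gen_zero, gen_one, gen_two, rootVal_zero, rootVal_one,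
        rootVal_two, wallLevel_zero, wallLevel_one, wallLevel_two] at *
      omega

/-! ### Lattice points and elements of `W` -/

open Classical in
/-- The element of `W` whose alcove has a given center. -/
noncomputable def elt (P : ℤ × ℤ) : W :=
  if h : ∃ i, sep (gen i P) < sep P then s h.choose * elt (gen h.choose P) else 1
termination_by sep P
decreasing_by exact h.choose_spec

/-- The chosen descent does not matter: two different choices, continued along the two braid words,
reach the same point by `gen_braid` and collect the same element by `s_braid`. -/
theorem elt_eq_of_descent {P : ℤ × ℤ} (hP : Regular P) {i : ZMod 3}
    (hi : sep (gen i P) < sep P) : elt P = s i * elt (gen i P) := by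
  induction hn : sep P using Nat.strong_induction_on generalizing P i with
  | _ n ih =>
    subst hn
    have h : ∃ i, sep (gen i P) < sep P := ⟨i, hi⟩
    rw [elt, dif_pos h]
    generalize hj : h.choose = j
    have hjd : sep (gen j P) < sep P := hj ▸ h.choose_spec
    by_cases hij : i = j
    · rw [hij]
    · obtain ⟨a1, a2⟩ := descent_chain hP hij hi hjd
      obtain ⟨b1, b2⟩ := descent_chain hP (Ne.symm hij) hjd hi
      rw [ih _ hi (hP.gen i) a1 rfl, ih _ (a1.trans hi) ((hP.gen i).gen j) a2 rfl,
        ih _ hjd (hP.gen j) b1 rfl, ih _ (b1.trans hjd) ((hP.gen j).gen i) b2 rfl, gen_braid hij]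
      simp only [← mul_assoc, s_braid hij]

theorem elt_base : elt (-1, -1) = 1 := by
  rw [elt, dif_neg]
  rintro ⟨i, hi⟩
  have : sep (-1, -1) = 0 := rfl
  omega

theorem elt_gen {P : ℤ × ℤ} (hP : Regular P) (i : ZMod 3) : elt (gen i P) = s i * elt P := by
  rcases lt_or_ge (sep (gen i P)) (sep P) with h | h
  · rw [elt_eq_of_descent hP h, s_mul_s_mul]
  · have h' : sep (gen i (gen i P)) < sep (gen i P) := by
      rw [sep_gen_lt_iff (hP.gen i), gen_gen]
      refine (near_or_near_refl hP i (wallLevel i)).resolve_right fun h' => ?_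
      exact absurd ((sep_gen_lt_iff hP i).2 h') (not_lt.2 h)
    rw [elt_eq_of_descent (hP.gen i) h', gen_gen]

/-- This left inverse shows that distinct elements have distinct centers, so identities in `W` can
be verified on lattice points. -/
theorem elt_pt (z : W) : elt (pt z) = z := by
  induction z using induction_left with
  | one => rw [pt_one, elt_base]
  | mul i z h => rw [pt_s_mul, elt_gen (regular_pt z), h]

theorem pt_injective : Function.Injective pt :=
  Function.LeftInverse.injective elt_pt

theorem length_elt_le {P : ℤ × ℤ} (hP : Regular P) : cs.length (elt P) ≤ sep P := by
  induction hn : sep P using Nat.strong_induction_on generalizing P with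
  | _ n ih =>
    subst hn
    by_cases h : ∃ i, sep (gen i P) < sep P
    · obtain ⟨i, hi⟩ := h
      have h2 := ih _ hi (hP.gen i) rfl
      rw [elt_eq_of_descent hP hi]
      refine (cs.length_mul_le _ _).trans ?_
      have : cs.length (s i) = 1 := cs.length_simple i
      omega
    · rw [eq_base_of_not_descent hP (not_exists.1 h), elt_base]
      simp

/-- Descending to the base point spells a word with at most `sep` letters; conversely each letter of
a reduced word adds at most one separating line. -/
theorem length_eq_sep (z : W) : cs.length z = sep (pt z) := by
  refine le_antisymm ?_ ?_
  · have := length_elt_le (regular_pt z)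
    rwa [elt_pt] at this
  · obtain ⟨ω, hω, rfl⟩ := cs.exists_isReduced z
    rw [hω.eq]
    clear hω
    induction ω with
    | nil => simp [pt_one, sep]
    | cons i ω ih =>
      rw [cs.wordProd_cons]
      have h1 := pt_s_mul i (cs.wordProd ω)
      rw [s] at h1
      rw [h1, List.length_cons]
      exact (sep_gen_le (regular_pt _) i).trans (by omega)

/-! ### Reflections and the Bruhat order -/

theorem exists_gen_refl_gen (i d : ZMod 3) (k : ℤ) :
    ∃ d' k', ∀ P, gen i (refl d k (gen i P)) = refl d' k' P := by
  rcases zmod_three_cases i with rfl | rfl | rfl <;>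
    rcases zmod_three_cases d with rfl | rfl | rfl
  · refine ⟨0, -k - 2, ?_⟩
    rintro ⟨a, b⟩
    simp only [gen_zero, refl_zero, Prod.mk.injEq]; omega
  · refine ⟨2, -k - 1, ?_⟩
    rintro ⟨a, b⟩
    simp only [gen_zero, refl_one, refl_two, Prod.mk.injEq]; omega
  · refine ⟨1, -k - 1, ?_⟩
    rintro ⟨a, b⟩
    simp only [gen_zero, refl_one, refl_two, Prod.mk.injEq]; omega
  · refine ⟨2, k, ?_⟩
    rintro ⟨a, b⟩
    simp only [gen_one, refl_zero, refl_two, Prod.mk.injEq]; omega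
  · refine ⟨1, -k, ?_⟩
    rintro ⟨a, b⟩
    simp only [gen_one, refl_one, Prod.mk.injEq, and_true]; omega
  · refine ⟨0, k, ?_⟩
    rintro ⟨a, b⟩
    simp only [gen_one, refl_zero, refl_two, Prod.mk.injEq]; omega
  · refine ⟨1, k, ?_⟩
    rintro ⟨a, b⟩
    simp only [gen_two, refl_zero, refl_one, Prod.mk.injEq]; omega
  · refine ⟨0, k, ?_⟩
    rintro ⟨a, b⟩
    simp only [gen_two, refl_zero, refl_one, Prod.mk.injEq]; omega
  · refine ⟨2, -k, ?_⟩
    rintro ⟨a, b⟩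
    simp only [gen_two, refl_two, Prod.mk.injEq, true_and]; omega

theorem exists_refl_of_isReflection {t : W} (ht : cs.IsReflection t) :
    ∃ d k, ∀ u, pt (t * u) = refl d k (pt u) := by
  obtain ⟨w, i, rfl⟩ := ht
  induction w using induction_left with
  | one => exact ⟨i, wallLevel i, fun u => by rw [one_mul, inv_one, mul_one]; exact pt_s_mul i u⟩
  | mul j w ih =>
    obtain ⟨d, k, h⟩ := ih
    obtain ⟨d', k', h'⟩ := exists_gen_refl_gen j d k
    refine ⟨d', k', fun u => ?_⟩
    rw [← h', ← pt_s_mul, ← h, ← pt_s_mul, mul_inv_rev, s_inv]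
    simp only [mul_assoc]

/-- The transformation of the lattice is induced by a reflection in `W`. -/
def Realized (f : ℤ × ℤ → ℤ × ℤ) : Prop :=
  ∃ t, cs.IsReflection t ∧ ∀ u, pt (t * u) = f (pt u)

theorem Realized.conj {f g : ℤ × ℤ → ℤ × ℤ} (h : Realized f) (i : ZMod 3)
    (hg : ∀ P, g P = gen i (f (gen i P))) : Realized g := by
  obtain ⟨t, ht, h⟩ := h
  refine ⟨s i * t * (s i)⁻¹, ht.conj (s i), fun u => ?_⟩
  rw [hg, ← pt_s_mul, ← h, ← pt_s_mul, s_inv]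
  simp only [mul_assoc]

theorem realized_gen (i : ZMod 3) : Realized (gen i) :=
  ⟨s i, cs.isReflection_simple i, pt_s_mul i⟩

theorem realized_refl_one_of_zero {k : ℤ} (h : Realized (refl 0 k)) : Realized (refl 1 k) := by
  refine h.conj 2 ?_
  rintro ⟨a, b⟩
  simp only [gen_two, refl_zero, refl_one, Prod.mk.injEq]; omega

theorem realized_refl_two_of_zero {k : ℤ} (h : Realized (refl 0 k)) : Realized (refl 2 k) := by
  refine h.conj 1 ?_
  rintro ⟨a, b⟩
  simp only [gen_one, refl_zero, refl_two, Prod.mk.injEq]; omega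

theorem realized_refl_zero_neg {k : ℤ} (h : Realized (refl 0 k)) : Realized (refl 0 (-k)) := by
  have h1 : Realized (refl 1 (-k)) := by
    refine (realized_refl_one_of_zero h).conj 1 ?_
    rintro ⟨a, b⟩
    simp only [gen_one, refl_one, Prod.mk.injEq, and_true]; omega
  refine h1.conj 2 ?_
  rintro ⟨a, b⟩
  simp only [gen_two, refl_zero, refl_one, Prod.mk.injEq]; omega

theorem realized_refl_zero_sub {k : ℤ} (h : Realized (refl 0 k)) :
    Realized (refl 0 (-k - 2)) := by
  refine h.conj 0 ?_
  rintro ⟨a, b⟩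
  simp only [gen_zero, refl_zero, Prod.mk.injEq]; omega

/-- Conjugation changes the level `k` to `-k` and to `-k - 2`, hence to `k + 2`. Two base levels are
needed: 0, and 1, which comes from the wall of `s 0` at level -1. -/
theorem realized_refl_zero_natCast (n : ℕ) : Realized (refl 0 n) := by
  induction n using Nat.strong_induction_on with
  | _ n ih =>
    match n with
    | 0 =>
      refine (realized_gen 1).conj 2 ?_
      rintro ⟨a, b⟩
      simp only [gen_one, gen_two, refl_zero, Prod.mk.injEq]; omega
    | 1 => exact realized_refl_zero_neg (k := -1) (realized_gen 0)
    | n + 2 =>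
      have := realized_refl_zero_neg (realized_refl_zero_sub (ih n (by omega)))
      rwa [show -(-(n : ℤ) - 2) = ((n + 2 : ℕ) : ℤ) by push_cast; ring] at this

theorem realized_refl (d : ZMod 3) (k : ℤ) : Realized (refl d k) := by
  have h0 : Realized (refl 0 k) := by
    obtain ⟨n, rfl | rfl⟩ := k.eq_nat_or_neg
    · exact realized_refl_zero_natCast n
    · exact realized_refl_zero_neg (realized_refl_zero_natCast n)
  rcases zmod_three_cases d with rfl | rfl | rfl
  · exact h0
  · exact realized_refl_one_of_zero h0
  · exact realized_refl_two_of_zero h0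

theorem le_refl (x : W) : le x x := Relation.ReflTransGen.refl

theorem le_trans {x y z : W} (h : le x y) (h' : le y z) : le x z :=
  Relation.ReflTransGen.trans h h'

theorem mem_of_le {H : Set (ℤ × ℤ)}
    (hH : ∀ P d k, Regular P → Near d k P → refl d k P ∈ H → P ∈ H) {x y : W} (h : le x y)
    (hy : pt y ∈ H) : pt x ∈ H := by
  induction h using Relation.ReflTransGen.head_induction_on with
  | refl => exact hy
  | @head u w h _ ih =>
    obtain ⟨h1, h2⟩ := h
    -- The Bruhat order multiplies by reflections on the right, the geometric action on the left;
    -- conjugating by `u` passes between them.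
    have h3 : cs.IsReflection (u * (u⁻¹ * w) * u⁻¹) := h1.conj u
    obtain ⟨d, k, h4⟩ := exists_refl_of_isReflection h3
    have h5 : pt w = refl d k (pt u) := by
      rw [← h4]; congr 1; group
    rw [length_eq_sep, length_eq_sep, h5] at h2
    refine hH _ d k (regular_pt u) ((sep_lt_sep_refl_iff (regular_pt u)).1 h2) ?_
    rw [← h5]; exact ih

theorem exists_le_of_near {x : W} {d : ZMod 3} {k : ℤ} (h : Near d k (pt x)) :
    ∃ x', pt x' = refl d k (pt x) ∧ le x x' := by
  obtain ⟨t, ht, h'⟩ := realized_refl d k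
  refine ⟨t * x, h' x, Relation.ReflTransGen.single ⟨?_, ?_⟩⟩
  · have := ht.conj x⁻¹
    rwa [inv_inv, mul_assoc] at this
  · rw [length_eq_sep, length_eq_sep, h']
    exact sep_lt_sep_refl (regular_pt x) h

/-! ### Diagram automorphisms -/

/-- The rotation about the center of the fundamental alcove by which `δ` acts. -/
def rot (P : ℤ × ℤ) : ℤ × ℤ := (-2 - P.2, P.1 - P.2 - 1)

theorem rot_gen (i : ZMod 3) (P : ℤ × ℤ) : rot (gen i P) = gen (i + 1) (rot P) := by
  obtain ⟨a, b⟩ := P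
  have h2 : (2 : ZMod 3) + 1 = 0 := rfl
  have h1 : (1 : ZMod 3) + 1 = 2 := rfl
  rcases zmod_three_cases i with rfl | rfl | rfl <;>
    simp only [zero_add, h1, h2, rot, gen_zero, gen_one, gen_two, Prod.mk.injEq, true_and] <;> omega

theorem swap_gen (i : ZMod 3) (P : ℤ × ℤ) : (gen i P).swap = gen (-i) P.swap := by
  obtain ⟨a, b⟩ := P
  have h2 : -(2 : ZMod 3) = 1 := rfl
  have h1 : -(1 : ZMod 3) = 2 := rfl
  rcases zmod_three_cases i with rfl | rfl | rfl <;>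
    simp only [neg_zero, h1, h2, Prod.swap_prod_mk, gen_zero, gen_one, gen_two]

theorem pt_δ (z : W) : pt (δ z) = rot (pt z) := by
  induction z using induction_left with
  | one => rw [map_one, pt_one]; rfl
  | mul i z h => rw [map_mul, δ_s, pt_s_mul, h, pt_s_mul, rot_gen]

theorem pt_σ (z : W) : pt (σ z) = (pt z).swap := by
  induction z using induction_left with
  | one => rw [map_one, pt_one]; rfl
  | mul i z h => rw [map_mul, σ_s, pt_s_mul, h, pt_s_mul, swap_gen]

theorem rot_rot_rot (P : ℤ × ℤ) : rot (rot (rot P)) = P := by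
  obtain ⟨a, b⟩ := P
  simp only [rot, Prod.mk.injEq]; omega

theorem δ_mul_δ_mul_δ : δ * δ * δ = 1 := by
  ext z
  apply pt_injective
  change pt (δ (δ (δ z))) = pt z
  rw [pt_δ, pt_δ, pt_δ, rot_rot_rot]

theorem σ_mul_σ : σ * σ = 1 := by
  ext z
  apply pt_injective
  change pt (σ (σ z)) = pt z
  rw [pt_σ, pt_σ, Prod.swap_swap]

theorem δ_inv : δ⁻¹ = δ * δ := by
  rw [inv_eq_iff_mul_eq_one, ← mul_assoc, δ_mul_δ_mul_δ]

theorem σ_inv : σ⁻¹ = σ := by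
  rw [inv_eq_iff_mul_eq_one, σ_mul_σ]

theorem sep_rot {P : ℤ × ℤ} (hP : Regular P) : sep (rot P) = sep P := by
  obtain ⟨i, j, rfl | rfl⟩ := hP.exists_param
  · have : rot (2 * i + j + 1, i + 2 * j + 1) =
        (2 * (-i - j - 2) + i + 1, -i - j - 2 + 2 * i + 1) := by
      simp only [rot, Prod.mk.injEq]; omega
    rw [this, sep_param_one, sep_param_one]; omega
  · have : rot (2 * i + j + 2, i + 2 * j + 2) =
        (2 * (-i - j - 3) + i + 2, -i - j - 3 + 2 * i + 2) := by
      simp only [rot, Prod.mk.injEq]; omega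
    rw [this, sep_param_two, sep_param_two]; omega

theorem sep_swap (P : ℤ × ℤ) : sep P.swap = sep P := by
  simp only [sep, Prod.fst_swap, Prod.snd_swap, add_comm]

theorem length_δ (z : W) : cs.length (δ z) = cs.length z := by
  rw [length_eq_sep, length_eq_sep, pt_δ, sep_rot (regular_pt z)]

theorem length_σ (z : W) : cs.length (σ z) = cs.length z := by
  rw [length_eq_sep, length_eq_sep, pt_σ, sep_swap]

theorem le_map (f : MulAut W) (hl : ∀ z, cs.length (f z) = cs.length z)
    (hs : ∀ i, ∃ j, f (s i) = s j) {x y : W} (h : le x y) : le (f x) (f y) := by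
  refine Relation.ReflTransGen.lift f ?_ x y h
  rintro u w ⟨⟨v, i, hv⟩, h2⟩
  obtain ⟨j, hj⟩ := hs i
  refine ⟨⟨f v, j, ?_⟩, by rwa [hl, hl]⟩
  rw [← map_inv, ← map_mul, hv, map_mul, map_mul, map_inv]
  exact congrArg (fun t => f v * t * (f v)⁻¹) hj

theorem le_δ {x y : W} (h : le x y) : le (δ x) (δ y) :=
  le_map δ length_δ (fun i => ⟨_, δ_s i⟩) h

theorem le_σ {x y : W} (h : le x y) : le (σ x) (σ y) :=
  le_map σ length_σ (fun i => ⟨_, σ_s i⟩) h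

theorem le_δ_iff {x y : W} : le (δ x) (δ y) ↔ le x y := by
  refine ⟨fun h => ?_, le_δ⟩
  have h3 : ∀ z, δ (δ (δ z)) = z := fun z => DFunLike.congr_fun δ_mul_δ_mul_δ z
  have := le_δ (le_δ h)
  rwa [h3, h3] at this

theorem le_σ_iff {x y : W} : le (σ x) (σ y) ↔ le x y := by
  refine ⟨fun h => ?_, le_σ⟩
  have h3 : ∀ z, σ (σ z) = z := fun z => DFunLike.congr_fun σ_mul_σ z
  have := le_σ h
  rwa [h3, h3] at this

/-! ### Hexagons with sides parallel to the roots -/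

/-- The bounds of a hexagon, possibly degenerate, with sides parallel to the roots. -/
structure Hexagon where
  l₁ : ℤ
  u₁ : ℤ
  l₂ : ℤ
  u₂ : ℤ
  l₃ : ℤ
  u₃ : ℤ

namespace Hexagon

/-- The integral points of a hexagon. -/
def points (h : Hexagon) : Set (ℤ × ℤ) :=
  {P | (h.l₁ ≤ P.1 ∧ P.1 ≤ h.u₁) ∧ (h.l₂ ≤ P.2 ∧ P.2 ≤ h.u₂) ∧
    (h.l₃ ≤ P.1 - P.2 ∧ P.1 - P.2 ≤ h.u₃)}

/-- The intersections of the consecutive lines that bound a hexagon. -/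
def vertices (h : Hexagon) : Set (ℤ × ℤ) :=
  {(h.u₁, h.u₂), (h.u₁, h.u₁ - h.u₃), (h.l₂ + h.u₃, h.l₂), (h.l₁, h.l₂), (h.l₁, h.l₁ - h.l₃),
    (h.u₂ + h.l₃, h.u₂)}

/-- All bounds are attained, along an edge or at a vertex. -/
def Tight (h : Hexagon) : Prop := h.vertices ⊆ h.points

theorem mem_points {h : Hexagon} {a b : ℤ} : (a, b) ∈ h.points ↔ (h.l₁ ≤ a ∧ a ≤ h.u₁) ∧
    (h.l₂ ≤ b ∧ b ≤ h.u₂) ∧ (h.l₃ ≤ a - b ∧ a - b ≤ h.u₃) := Iff.rfl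

theorem tight_iff {h : Hexagon} : h.Tight ↔
    (h.u₁, h.u₂) ∈ h.points ∧ (h.u₁, h.u₁ - h.u₃) ∈ h.points ∧
      (h.l₂ + h.u₃, h.l₂) ∈ h.points ∧ (h.l₁, h.l₂) ∈ h.points ∧
      (h.l₁, h.l₁ - h.l₃) ∈ h.points ∧ (h.u₂ + h.l₃, h.u₂) ∈ h.points := by
  simp only [Tight, vertices, Set.insert_subset_iff, Set.singleton_subset_iff]

/-- The image of a hexagon under `rot`. -/
def rotate (h : Hexagon) : Hexagon :=
  ⟨-2 - h.u₂, -2 - h.l₂, h.l₃ - 1, h.u₃ - 1, -1 - h.u₁, -1 - h.l₁⟩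

/-- The mirror image of a hexagon. -/
def mirror (h : Hexagon) : Hexagon := ⟨h.l₂, h.u₂, h.l₁, h.u₁, -h.u₃, -h.l₃⟩

theorem rot_mem_rotate {h : Hexagon} {P : ℤ × ℤ} :
    rot P ∈ h.rotate.points ↔ P ∈ h.points := by
  obtain ⟨a, b⟩ := P
  simp only [rot, rotate, mem_points]; omega

theorem swap_mem_mirror {h : Hexagon} {P : ℤ × ℤ} :
    P.swap ∈ h.mirror.points ↔ P ∈ h.points := by
  obtain ⟨a, b⟩ := P
  simp only [Prod.swap_prod_mk, mirror, mem_points]; omega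

theorem Tight.rotate {h : Hexagon} (ht : h.Tight) : h.rotate.Tight := by
  simp only [tight_iff, mem_points, Hexagon.rotate] at *
  omega

theorem Tight.mirror {h : Hexagon} (ht : h.Tight) : h.mirror.Tight := by
  simp only [tight_iff, mem_points, Hexagon.mirror] at *
  omega

theorem image_rot_vertices (h : Hexagon) : rot '' h.vertices = h.rotate.vertices := by
  have e1 : rot (h.u₁, h.u₂) = (h.rotate.l₁, h.rotate.l₁ - h.rotate.l₃) := by
    simp only [rot, rotate, Prod.mk.injEq, true_and]; omega
  have e2 : rot (h.u₁, h.u₁ - h.u₃) = (h.rotate.u₂ + h.rotate.l₃, h.rotate.u₂) := by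
    simp only [rot, rotate, Prod.mk.injEq]; omega
  have e3 : rot (h.l₂ + h.u₃, h.l₂) = (h.rotate.u₁, h.rotate.u₂) := by
    simp only [rot, rotate, Prod.mk.injEq, true_and]; omega
  have e4 : rot (h.l₁, h.l₂) = (h.rotate.u₁, h.rotate.u₁ - h.rotate.u₃) := by
    simp only [rot, rotate, Prod.mk.injEq, true_and]; omega
  have e5 : rot (h.l₁, h.l₁ - h.l₃) = (h.rotate.l₂ + h.rotate.u₃, h.rotate.l₂) := by
    simp only [rot, rotate, Prod.mk.injEq]; omega
  have e6 : rot (h.u₂ + h.l₃, h.u₂) = (h.rotate.l₁, h.rotate.l₂) := by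
    simp only [rot, rotate, Prod.mk.injEq, true_and]; omega
  simp only [vertices, Set.image_insert_eq, Set.image_singleton, e1, e2, e3, e4, e5, e6]
  ext P
  simp only [Set.mem_insert_iff, Set.mem_singleton_iff]
  tauto

theorem image_swap_vertices (h : Hexagon) : Prod.swap '' h.vertices = h.mirror.vertices := by
  have e2 : h.u₁ - h.u₃ = h.mirror.u₂ + h.mirror.l₃ := rfl
  have e3 : h.l₂ + h.u₃ = h.mirror.l₁ - h.mirror.l₃ := by simp only [mirror]; omega
  have e5 : h.l₁ - h.l₃ = h.mirror.l₂ + h.mirror.u₃ := rfl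
  have e6 : h.u₂ + h.l₃ = h.mirror.u₁ - h.mirror.u₃ := by simp only [mirror]; omega
  simp only [vertices, Set.image_insert_eq, Set.image_singleton, Prod.swap_prod_mk]
  rw [e2, e3, e5, e6]
  ext P
  simp only [mirror, Set.mem_insert_iff, Set.mem_singleton_iff]
  tauto

/-- The condition on the bounds that makes a hexagon stable under folding towards the fundamental
alcove. -/
def Balanced (h : Hexagon) : Prop :=
  (h.u₂ ≤ h.u₃ ∧ h.u₃ ≤ -h.l₁ ∧ -h.l₁ ≤ h.u₂ + 3) ∧
    (h.u₁ ≤ -h.l₃ ∧ -h.l₃ ≤ -h.l₂ ∧ -h.l₂ ≤ h.u₁ + 3)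

/-- The functionals `b, a - b, -a` and `a, b - a, -b` are two orbits of the finite Weyl group, and
`Balanced` says that their upper bounds weakly increase along each orbit, by at most 3 in total. A
reflection at level `k` fixes one functional of each orbit and exchanges the other two up to the
shift `3 * k`. Moving to the near side lowers one of these two; the other is controlled by the
monotonicity if `0 ≤ k`, and if `k ≤ -1` the shift by at least 3 absorbs the increase. -/
theorem Balanced.mem_of_refl_mem {h : Hexagon} (hb : h.Balanced) (P : ℤ × ℤ) (d : ZMod 3) (k : ℤ)
    (_ : Regular P) (hk : Near d k P) (hm : refl d k P ∈ h.points) : P ∈ h.points := by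
  obtain ⟨a, b⟩ := P
  simp only [Balanced] at hb
  rcases zmod_three_cases d with rfl | rfl | rfl <;>
    simp only [Near, rootVal_zero, rootVal_one, rootVal_two, refl_zero, refl_one, refl_two,
      mem_points] at * <;>
    rcases hk with hk | hk <;> omega

/-- No upward reflection of the point stays in the hexagon. -/
def IsTop (h : Hexagon) (P : ℤ × ℤ) : Prop :=
  P ∈ h.points ∧ ∀ d k, Near d k P → refl d k P ∉ h.points

theorem exists_sep_le (h : Hexagon) : ∃ N, ∀ P ∈ h.points, sep P ≤ N := by
  refine ⟨10 * (h.l₁.natAbs + h.u₁.natAbs + h.l₂.natAbs + h.u₂.natAbs) + 10, ?_⟩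
  rintro ⟨a, b⟩ hP
  simp only [mem_points] at hP
  simp only [sep]
  omega

theorem le_iff_mem {h : Hexagon} (hb : h.Balanced) {y : W} (hy : pt y ∈ h.points)
    (htop : ∀ P, Regular P → h.IsTop P → P = pt y) (x : W) : le x y ↔ pt x ∈ h.points := by
  refine ⟨fun hx => mem_of_le hb.mem_of_refl_mem hx hy, fun hx => ?_⟩
  -- An upward reflection raises `sep`, which is bounded on the hexagon, so the climb inside it ends
  -- at a top.
  obtain ⟨N, hN⟩ := h.exists_sep_le
  induction hn : N - sep (pt x) using Nat.strong_induction_on generalizing x with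
  | _ n ih =>
    by_cases ht : h.IsTop (pt x)
    · rw [pt_injective (htop _ (regular_pt x) ht)]
      exact le_refl y
    · simp only [IsTop, hx, true_and, not_forall, not_not] at ht
      obtain ⟨d, k, hk, hm⟩ := ht
      obtain ⟨x', hx', hle⟩ := exists_le_of_near hk
      have h1 := sep_lt_sep_refl (regular_pt x) hk
      have h2 := hN _ hm
      rw [← hx'] at h1 h2 hm
      exact le_trans hle (ih _ (by omega) x' hm rfl)

end Hexagon

/-- The lower interval of `y` consists of the lattice points of the hexagon whose vertices are the
points of `V`. -/
def Describes (V : Set W) (y : W) : Prop :=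
  ∃ h : Hexagon, h.Tight ∧ pt '' V = h.vertices ∧ ∀ x, le x y ↔ pt x ∈ h.points

theorem Describes.δ {V : Set W} {y : W} (h : Describes V y) : Describes (δ '' V) (δ y) := by
  obtain ⟨h, h1, h2, h3⟩ := h
  refine ⟨h.rotate, h1.rotate, ?_, fun x => ?_⟩
  · rw [← h.image_rot_vertices, ← h2, Set.image_image, Set.image_image]
    simp only [pt_δ]
  · obtain ⟨x, rfl⟩ := AffineA2.δ.surjective x
    rw [le_δ_iff, h3, pt_δ, Hexagon.rot_mem_rotate]

theorem Describes.σ {V : Set W} {y : W} (h : Describes V y) : Describes (σ '' V) (σ y) := by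
  obtain ⟨h, h1, h2, h3⟩ := h
  refine ⟨h.mirror, h1.mirror, ?_, fun x => ?_⟩
  · rw [← h.image_swap_vertices, ← h2, Set.image_image, Set.image_image]
    simp only [pt_σ]
  · obtain ⟨x, rfl⟩ := AffineA2.σ.surjective x
    rw [le_σ_iff, h3, pt_σ, Hexagon.swap_mem_mirror]

theorem Describes.map {V : Set W} {y : W} (h : Describes V y) {g : MulAut W}
    (hg : g ∈ Subgroup.closure {AffineA2.δ, AffineA2.σ}) : Describes (g '' V) (g y) := by
  have mul : ∀ (f g : MulAut W), Describes (f '' (g '' V)) (f (g y)) →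
      Describes ((f * g : MulAut W) '' V) ((f * g : MulAut W) y) := by
    intro f g h
    rwa [Set.image_image] at h
  induction hg using Subgroup.closure_induction_left with
  | one => simpa using h
  | mul_left f hf g _ ih =>
    refine mul f g ?_
    rcases hf with rfl | rfl
    · exact ih.δ
    · exact ih.σ
  | inv_mul_cancel f hf g _ ih =>
    refine mul f⁻¹ g ?_
    rcases hf with rfl | rfl
    · rw [δ_inv]
      have := ih.δ.δ
      rwa [Set.image_image] at this
    · rw [σ_inv]
      exact ih.σ

/-! ### Uniqueness of the top point for each family of hexagons. -/

namespace Hexagon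

/-- The hexagon is stable under the finite Weyl group, so the walls at level 0 force a top into the
dominant chamber. There the next lines outward have levels `i + 1`, `j + 1`, and `i + j + 1` or `i +
j + 2` depending on the orientation; only at `(a, b)` are all these reflections blocked. -/
theorem isTop_dominant {a b : ℤ} (hab : Regular (a, b)) (hp : 0 < 2 * a - b) (hq : 0 < 2 * b - a)
    {P : ℤ × ℤ} (hP : Regular P) (ht : IsTop ⟨-b, a, -a, b, -a, b⟩ P) : P = (a, b) := by
  obtain ⟨hm, ht⟩ := ht
  obtain ⟨i, j, rfl | rfl⟩ := hP.exists_param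
  all_goals
    have p0 := ht 1 0
    have q0 := ht 2 0
    have p1 := ht 1 (i + 1)
    have q1 := ht 2 (j + 1)
    have r1 := ht 0 (i + j + 1)
    have r2 := ht 0 (i + j + 2)
    simp only [Regular, Near, rootVal_zero, rootVal_one, rootVal_two, refl_zero, refl_one,
      refl_two, mem_points] at *
    clear ht
    have hi : 0 ≤ i := by omega
    have hj : 0 ≤ j := by omega
    clear p0 q0
    rw [Prod.mk.injEq]
    omega

/-- The hexagon is symmetric under `s 0`, so a top lies beyond the line of level -1 for `ρ`. On this
negative side the next line outward has the integer part itself as its level, hence `i`, `j`, and `i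
+ j` or `i + j + 1`. -/
theorem isTop_opposite {a b : ℤ} (hab : Regular (a, b)) (hp : 0 < 2 * a - b) (hq : 0 < 2 * b - a)
    {P : ℤ × ℤ} (hP : Regular P) (ht : IsTop ⟨-b - 3, a, -a - 3, b, -a, b⟩ P) :
    P = (-b - 3, -a - 3) := by
  obtain ⟨hm, ht⟩ := ht
  obtain ⟨i, j, rfl | rfl⟩ := hP.exists_param
  all_goals
    have p0 := ht 1 (-1)
    have q0 := ht 2 (-1)
    have r0 := ht 0 (-1)
    have p1 := ht 1 i
    have q1 := ht 2 j
    have r1 := ht 0 (i + j)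
    have r2 := ht 0 (i + j + 1)
    simp only [Regular, Near, rootVal_zero, rootVal_one, rootVal_two, refl_zero, refl_one,
      refl_two, mem_points] at *
    clear ht
    have hr : i + j < -1 := by omega
    clear r0
    have hi : i < -1 := by omega
    have hj : j < -1 := by omega
    clear p0 q0
    rw [Prod.mk.injEq]
    omega

/-- Symmetry under `s 1` gives `0 ≤ i`. Where `0 ≤ j`, the upper bound on the second coordinate
leaves room for an upward reflection along `α₁`, so a top has `j ≤ -1`. Reflections along `α₂` are
never needed. -/
theorem isTop_strip {a b : ℤ} (hb : 0 ≤ b) (hab : a = 2 * b + 1 ∨ a = 2 * b + 2)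
    {P : ℤ × ℤ} (hP : Regular P) (ht : IsTop ⟨b - a, a, -a, b, -a, a - b⟩ P) : P = (a, b) := by
  obtain ⟨hm, ht⟩ := ht
  obtain ⟨i, j, rfl | rfl⟩ := hP.exists_param
  · have p0 := ht 1 0
    have p1 := ht 1 (i + 1)
    have r0 := ht 0 0
    have r1 := ht 0 (i + j + 1)
    simp only [Near, rootVal_zero, rootVal_one, refl_zero, refl_one, mem_points] at hm p0 p1 r0 r1
    clear ht hP
    have hi : 0 ≤ i := by clear p1 r0 r1; omega
    have hj : j ≤ -1 := by clear p0 r0 r1; omega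
    rw [Prod.mk.injEq]
    clear p0 p1
    omega
  · have p0 := ht 1 0
    have p1 := ht 1 (i + 1)
    have r0 := ht 0 0
    have r1 := ht 0 (i + j + 2)
    simp only [Near, rootVal_zero, rootVal_one, refl_zero, refl_one, mem_points] at hm p0 p1 r0 r1
    clear ht hP
    have hi : 0 ≤ i := by clear p1 r0 r1; omega
    have hj : j ≤ -1 := by clear p0 r0 r1; omega
    rw [Prod.mk.injEq]
    clear p0
    -- Inside the strip the reflection along `α₁` decides; below it, those along `ρ`.
    rcases (show j = -1 ∨ j ≤ -2 by omega) with rfl | hj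
    · clear r0 r1
      omega
    · clear p1
      omega

theorem isTop_one {P : ℤ × ℤ} (ht : IsTop ⟨-1, -1, -1, -1, 0, 0⟩ P) :
    P = (-1, -1) := by
  obtain ⟨a, b⟩ := P
  have hm := ht.1
  simp only [mem_points] at hm
  rw [Prod.mk.injEq]
  omega

theorem isTop_simple {P : ℤ × ℤ} (ht : IsTop ⟨-1, 0, -1, -1, 0, 1⟩ P) :
    P = (0, -1) := by
  obtain ⟨a, b⟩ := P
  obtain ⟨hm, ht⟩ := ht
  have p0 := ht 1 0
  simp only [Near, rootVal_one, refl_one, mem_points] at hm p0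
  rw [Prod.mk.injEq]
  omega

end Hexagon

/-! ### The elements `x_k` and the set `D` -/

theorem xElt_zero : xElt 0 = 1 := rfl

/-- After the first letter is removed, the remaining word is the shorter one with all indices raised
by 1. Thus the `xElt k` are the iterates of a single glide reflection. -/
theorem xElt_succ (k : ℕ) : xElt (k + 1) = s 1 * δ (xElt k) := by
  rw [xElt, xElt, List.range_succ_eq_map, List.map_cons, List.prod_cons, map_list_prod,
    List.map_map, List.map_map]
  congr 2
  refine List.map_congr_left fun j _ => ?_
  simp only [Function.comp_apply, δ_s, Nat.succ_eq_add_one]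
  congr 1
  push_cast
  ring

theorem xElt_mul (k : ℕ) (u : W) : xElt (k + 1) * (δ ^ (k + 1)) u = s 1 * δ (xElt k * (δ ^ k) u) := by
  rw [xElt_succ, map_mul, mul_assoc, pow_succ' δ k]
  rfl

/-- The glide reflection by which `s 1` after `δ` acts. -/
def glide (P : ℤ × ℤ) : ℤ × ℤ := (P.1 + 1, P.1 - P.2 - 1)

theorem pt_s_mul_δ (z : W) : pt (s 1 * δ z) = glide (pt z) := by
  rw [pt_s_mul, pt_δ]
  generalize pt z = P
  obtain ⟨a, b⟩ := P
  simp only [rot, gen_one, glide, Prod.mk.injEq, and_true]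
  omega

/-- The square of the glide reflection is the translation by `ϖ₁`, which has coordinates `(2, 1)`.
-/
theorem glide_glide_iterate (m : ℕ) (a b : ℤ) : glide^[2 * m] (a, b) = (a + 2 * m, b + m) := by
  induction m with
  | zero => simp
  | succ m ih =>
    rw [show 2 * (m + 1) = (2 * m + 1) + 1 by ring, Function.iterate_succ_apply',
      Function.iterate_succ_apply', ih]
    simp only [glide, Prod.mk.injEq]
    push_cast
    omega

theorem pt_xElt_mul (k : ℕ) (u : W) : pt (xElt k * (δ ^ k) u) = glide^[k] (pt u) := by
  induction k with
  | zero => simp [xElt_zero]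
  | succ k ih => rw [xElt_mul, pt_s_mul_δ, ih, Function.iterate_succ_apply']

theorem pt_xElt (k : ℕ) : pt (xElt k) = glide^[k] (-1, -1) := by
  have := pt_xElt_mul k 1
  rwa [map_one, mul_one, pt_one] at this

theorem pt_xElt_even (j : ℕ) : pt (xElt (2 * j)) = (2 * (j : ℤ) - 1, (j : ℤ) - 1) := by
  rw [pt_xElt, glide_glide_iterate, Prod.mk.injEq]; omega

theorem pt_xElt_odd (j : ℕ) : pt (xElt (2 * j + 1)) = (2 * (j : ℤ), (j : ℤ) - 1) := by
  rw [pt_xElt, Function.iterate_succ_apply', glide_glide_iterate]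
  simp only [glide, Prod.mk.injEq]; omega

theorem pow_δ_s (k : ℕ) (i : ZMod 3) : (δ ^ k) (s i) = s (i + k) := by
  induction k with
  | zero => simp
  | succ k ih =>
    rw [pow_succ', MulAut.mul_apply, ih, δ_s]
    congr 1; push_cast; ring

/-- In the descending tail, the index `2 * m + 1 - j` equals `-(j + 1) + (2 * m + 2)`: negation is
`σ` and the shift is a power of `δ`. -/
theorem theta_eq (m n : ℕ) :
    theta m n = xElt (2 * m + 2) * (δ ^ (2 * m + 2)) (σ (xElt (2 * n + 1))) := by
  rw [theta, xElt.eq_1 (2 * n + 1), map_list_prod, map_list_prod, List.map_map, List.map_map]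
  congr 2
  refine List.map_congr_left fun j _ => ?_
  simp only [Function.comp_apply, σ_s, pow_δ_s]
  congr 1
  push_cast
  ring

theorem glide_iterate_turn (m : ℕ) (a b : ℤ) :
    glide^[2 * m + 2] (a, b) = (a + 2 * m + 2, b + m + 1) := by
  rw [show 2 * m + 2 = 2 * (m + 1) by ring, glide_glide_iterate, Prod.mk.injEq]
  push_cast
  omega

theorem pt_theta (m n : ℕ) : pt (theta m n) = (2 * (m : ℤ) + n + 1, (m : ℤ) + 2 * n + 1) := by
  rw [theta_eq, pt_xElt_mul, pt_σ, pt_xElt_odd, Prod.swap_prod_mk, glide_iterate_turn,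
    Prod.mk.injEq]
  omega

/-- The three neighbors of `θ(m, n)`. -/
theorem pt_theta_mul_s (m n : ℕ) (i : ZMod 3) :
    pt (theta m n * s (2 * m + 2 - (i + (2 * n + 1)))) =
      ((glide^[2 * n + 1] (gen i (-1, -1))).2 + 2 * m + 2,
        (glide^[2 * n + 1] (gen i (-1, -1))).1 + m + 1) := by
  have h : s (2 * m + 2 - (i + (2 * n + 1))) =
      (δ ^ (2 * m + 2)) (σ ((δ ^ (2 * n + 1)) (s i))) := by
    rw [pow_δ_s, σ_s, pow_δ_s]
    congr 1
    push_cast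
    ring
  rw [theta_eq, h, mul_assoc, ← map_mul, ← map_mul, pt_xElt_mul, pt_σ, pt_xElt_mul, ← mul_one (s i),
    pt_s_mul, pt_one, ← glide_iterate_turn]
  rfl

theorem glide_iterate_odd (n : ℕ) (a b : ℤ) :
    glide^[2 * n + 1] (a, b) = (a + 2 * n + 1, a - b + n - 1) := by
  rw [Function.iterate_succ_apply', glide_glide_iterate]
  simp only [glide, Prod.mk.injEq, true_and]; omega

theorem pt_theta_mul_s_zero (m n : ℕ) :
    pt (theta m n * s (2 * m + 2 - (0 + (2 * n + 1)))) = (2 * (m : ℤ) + n + 1, (m : ℤ) + 2 * n) := by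
  rw [pt_theta_mul_s, gen_zero, glide_iterate_odd, Prod.mk.injEq]; omega

theorem pt_theta_mul_s_one (m n : ℕ) :
    pt (theta m n * s (2 * m + 2 - (1 + (2 * n + 1)))) = (2 * (m : ℤ) + n + 2, (m : ℤ) + 2 * n + 2) := by
  rw [pt_theta_mul_s, gen_one, glide_iterate_odd, Prod.mk.injEq]; omega

theorem pt_theta_mul_s_two (m n : ℕ) :
    pt (theta m n * s (2 * m + 2 - (2 + (2 * n + 1)))) = (2 * (m : ℤ) + n, (m : ℤ) + 2 * n + 1) := by
  rw [pt_theta_mul_s, gen_two, glide_iterate_odd, Prod.mk.injEq]; omega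

theorem sep_theta (m n : ℕ) : sep (pt (theta m n)) = 2 * m + 2 * n + 3 := by
  rw [pt_theta, sep_param_one]; omega

theorem length_le_of_le {x y : W} (h : le x y) : cs.length x ≤ cs.length y := by
  induction h using Relation.ReflTransGen.head_induction_on with
  | refl => exact le_rfl
  | head h _ ih => exact h.2.le.trans ih

theorem length_lt_of_lt_mul_s {x : W} {i : ZMod 3} (h : lt x (x * s i)) :
    cs.length x < cs.length (x * s i) :=
  lt_of_le_of_ne (length_le_of_le h.1) (cs.length_mul_simple_ne x i).symm

theorem lt_mul_s_of_length_lt {x : W} {i : ZMod 3} (h : cs.length x < cs.length (x * s i)) :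
    lt x (x * s i) := by
  refine ⟨Relation.ReflTransGen.single ⟨?_, h⟩, fun he => ?_⟩
  · rw [inv_mul_cancel_left]
    exact cs.isReflection_simple i
  · rw [← he] at h
    exact lt_irrefl _ h

/-- Two of the three neighbors have fewer separating lines, so the length singles out the third. -/
theorem pt_of_lt_theta_mul_s {m n : ℕ} {i : ZMod 3} (h : lt (theta m n) (theta m n * s i)) :
    pt (theta m n * s i) = (2 * (m : ℤ) + n + 2, (m : ℤ) + 2 * n + 2) := by
  have hl := length_lt_of_lt_mul_s h
  rw [length_eq_sep, length_eq_sep, sep_theta] at hl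
  obtain ⟨j, rfl⟩ : ∃ j : ZMod 3, i = 2 * m + 2 - (j + (2 * n + 1)) :=
    ⟨2 * m + 2 - (2 * n + 1) - i, by ring⟩
  rcases zmod_three_cases j with rfl | rfl | rfl
  · rw [pt_theta_mul_s_zero, show ((2 * (m : ℤ) + n + 1, (m : ℤ) + 2 * n) : ℤ × ℤ) =
      (2 * (m : ℤ) + (n - 1) + 2, (m : ℤ) + 2 * (n - 1) + 2) by rw [Prod.mk.injEq]; omega,
      sep_param_two] at hl
    omega
  · exact pt_theta_mul_s_one m n
  · rw [pt_theta_mul_s_two, show ((2 * (m : ℤ) + n, (m : ℤ) + 2 * n + 1) : ℤ × ℤ) =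
      (2 * ((m : ℤ) - 1) + n + 2, (m : ℤ) - 1 + 2 * n + 2) by rw [Prod.mk.injEq]; omega,
      sep_param_two] at hl
    omega

/-- The point lies in the dominant chamber. -/
def Dominant (P : ℤ × ℤ) : Prop := 0 < 2 * P.1 - P.2 ∧ 0 < 2 * P.2 - P.1

/-- The two orientations in `Regular.exists_param`, with nonnegative parameters `m` and `n`, are the
centers of `θ(m, n)` and `θˢ(m, n)`. -/
theorem mem_D_iff {y : W} : y ∈ D ↔ Dominant (pt y) := by
  constructor
  · rintro ⟨m, n, rfl | ⟨i, h, rfl⟩⟩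
    · rw [pt_theta]; simp only [Dominant]; omega
    · rw [pt_of_lt_theta_mul_s h]; simp only [Dominant]; omega
  · intro h
    obtain ⟨i, j, hij | hij⟩ := (regular_pt y).exists_param
    · rw [hij] at h
      simp only [Dominant] at h
      obtain ⟨m, rfl⟩ := Int.eq_ofNat_of_zero_le (show 0 ≤ i by omega)
      obtain ⟨n, rfl⟩ := Int.eq_ofNat_of_zero_le (show 0 ≤ j by omega)
      exact ⟨m, n, Or.inl (pt_injective (by rw [hij, pt_theta]))⟩
    · rw [hij] at h
      simp only [Dominant] at h
      obtain ⟨m, rfl⟩ := Int.eq_ofNat_of_zero_le (show 0 ≤ i by omega)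
      obtain ⟨n, rfl⟩ := Int.eq_ofNat_of_zero_le (show 0 ≤ j by omega)
      refine ⟨m, n, Or.inr ⟨2 * m + 2 - (1 + (2 * n + 1)), lt_mul_s_of_length_lt ?_,
        pt_injective (by rw [hij, pt_theta_mul_s_one])⟩⟩
      rw [length_eq_sep, length_eq_sep, sep_theta, pt_theta_mul_s_one, sep_param_two]
      omega

/-! ### The hexagons of the elements of `W` -/

theorem describes_one : Describes {1} 1 := by
  refine ⟨⟨-1, -1, -1, -1, 0, 0⟩, ?_, ?_, Hexagon.le_iff_mem ?_ ?_ ?_⟩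
  · simp only [Hexagon.tight_iff, Hexagon.mem_points]; omega
  · simp [Hexagon.vertices, pt_one]
  · dsimp only [Hexagon.Balanced]; omega
  · simp only [pt_one, Hexagon.mem_points]; omega
  · intro P _ ht
    rw [pt_one, Hexagon.isTop_one ht]

theorem pt_s_one : pt (s 1) = (0, -1) := by
  rw [← mul_one (s 1), pt_s_mul, pt_one, gen_one]; rfl

theorem describes_s_one : Describes {1, s 1} (s 1) := by
  refine ⟨⟨-1, 0, -1, -1, 0, 1⟩, ?_, ?_, Hexagon.le_iff_mem ?_ ?_ ?_⟩
  · simp only [Hexagon.tight_iff, Hexagon.mem_points]; omega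
  · simp only [Hexagon.vertices, Set.image_insert_eq, Set.image_singleton, pt_one, pt_s_one]
    ext P
    simp only [Set.mem_insert_iff, Set.mem_singleton_iff, add_zero, zero_sub, sub_zero,
      neg_add_cancel]
    tauto
  · dsimp only [Hexagon.Balanced]; omega
  · simp only [pt_s_one, Hexagon.mem_points]; omega
  · intro P _ ht
    rw [pt_s_one, Hexagon.isTop_simple ht]

theorem mul_mem_Wf {u v : W} (hu : u ∈ Wf) (hv : v ∈ Wf) : u * v ∈ Wf := Wf.mul_mem hu hv

theorem s_one_mem_Wf : s 1 ∈ Wf := Subgroup.subset_closure (by simp)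

theorem s_two_mem_Wf : s 2 ∈ Wf := Subgroup.subset_closure (by simp)

theorem image_pt_Wf {y : W} {a b : ℤ} (hy : pt y = (a, b)) :
    pt '' {u | ∃ w ∈ Wf, u = w * y} =
      {(a, b), (a, a - b), (b - a, -a), (-b, -a), (-b, a - b), (b - a, b)} := by
  refine Set.Subset.antisymm ?_ ?_
  · rintro _ ⟨_, ⟨w, hw, rfl⟩, rfl⟩
    have key : ∀ i : ZMod 3, (i = 1 ∨ i = 2) → ∀ P : ℤ × ℤ,
        P ∈ ({(a, b), (a, a - b), (b - a, -a), (-b, -a), (-b, a - b), (b - a, b)} :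
          Set (ℤ × ℤ)) → gen i P ∈ ({(a, b), (a, a - b), (b - a, -a), (-b, -a), (-b, a - b),
            (b - a, b)} : Set (ℤ × ℤ)) := by
      rintro i (rfl | rfl) P (rfl | rfl | rfl | rfl | rfl | rfl) <;>
        simp only [gen_one, gen_two, Set.mem_insert_iff, Set.mem_singleton_iff, Prod.mk.injEq,
          and_true, true_and, or_true, true_or] <;>
        omega
    have key' : ∀ x ∈ ({s 1, s 2} : Set W), ∃ i : ZMod 3, (i = 1 ∨ i = 2) ∧ x = s i := by
      rintro x (rfl | rfl)
      · exact ⟨1, Or.inl rfl, rfl⟩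
      · exact ⟨2, Or.inr rfl, rfl⟩
    induction hw using Subgroup.closure_induction_left with
    | one => rw [one_mul, hy]; exact Set.mem_insert _ _
    | mul_left x hx w _ ih =>
      obtain ⟨i, hi, rfl⟩ := key' x hx
      rw [mul_assoc, pt_s_mul]
      exact key i hi _ ih
    | inv_mul_cancel x hx w _ ih =>
      obtain ⟨i, hi, rfl⟩ := key' x hx
      rw [s_inv, mul_assoc, pt_s_mul]
      exact key i hi _ ih
  · have h1 := s_one_mem_Wf
    have h2 := s_two_mem_Wf
    rintro P (rfl | rfl | rfl | rfl | rfl | rfl)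
    · exact ⟨_, ⟨1, Wf.one_mem, rfl⟩, by rw [one_mul, hy]⟩
    · exact ⟨_, ⟨s 2, h2, rfl⟩, by rw [pt_s_mul, hy, gen_two]⟩
    · refine ⟨_, ⟨s 2 * s 1, mul_mem_Wf h2 h1, rfl⟩, ?_⟩
      rw [mul_assoc, pt_s_mul, pt_s_mul, hy, gen_one, gen_two, Prod.mk.injEq]; omega
    · refine ⟨_, ⟨s 1 * (s 2 * s 1), mul_mem_Wf h1 (mul_mem_Wf h2 h1), rfl⟩, ?_⟩
      rw [mul_assoc, mul_assoc, pt_s_mul, pt_s_mul, pt_s_mul, hy, gen_one, gen_two, gen_one,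
        Prod.mk.injEq]; omega
    · refine ⟨_, ⟨s 1 * s 2, mul_mem_Wf h1 h2, rfl⟩, ?_⟩
      rw [mul_assoc, pt_s_mul, pt_s_mul, hy, gen_two, gen_one, Prod.mk.injEq]; omega
    · exact ⟨_, ⟨s 1, h1, rfl⟩, by rw [pt_s_mul, hy, gen_one]⟩

theorem ncard_six {α : Type*} {x₁ x₂ x₃ x₄ x₅ x₆ : α}
    (h : [x₁, x₂, x₃, x₄, x₅, x₆].Nodup) : ({x₁, x₂, x₃, x₄, x₅, x₆} : Set α).ncard = 6 := by
  classical
  have e : (([x₁, x₂, x₃, x₄, x₅, x₆].toFinset : Finset α) : Set α) = {x₁, x₂, x₃, x₄, x₅, x₆} := by simp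
  rw [← e, Set.ncard_coe_finset, List.toFinset_card_of_nodup h]
  rfl

theorem ncard_four {α : Type*} {x₁ x₂ x₃ x₄ : α}
    (h : [x₁, x₂, x₃, x₄].Nodup) : ({x₁, x₂, x₃, x₄} : Set α).ncard = 4 := by
  classical
  have e : (([x₁, x₂, x₃, x₄].toFinset : Finset α) : Set α) = {x₁, x₂, x₃, x₄} := by simp
  rw [← e, Set.ncard_coe_finset, List.toFinset_card_of_nodup h]
  rfl

theorem ncard_image_pt (V : Set W) : (pt '' V).ncard = V.ncard :=
  Set.ncard_image_of_injective V pt_injective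

theorem describes_dominant {y : W} (hy : Dominant (pt y)) :
    Describes {u | ∃ w ∈ Wf, u = w * y} y ∧ {u | ∃ w ∈ Wf, u = w * y}.ncard = 6 := by
  have hr := regular_pt y
  obtain ⟨⟨a, b⟩, hP⟩ : ∃ P, pt y = P := ⟨_, rfl⟩
  rw [hP] at hy hr
  obtain ⟨hp, hq⟩ := hy
  simp only at hp hq
  refine ⟨⟨⟨-b, a, -a, b, -a, b⟩, ?_, ?_, Hexagon.le_iff_mem ?_ ?_ ?_⟩, ?_⟩
  · simp only [Hexagon.tight_iff, Hexagon.mem_points]; omega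
  · rw [image_pt_Wf hP, Hexagon.vertices]
    simp only [sub_neg_eq_add, neg_add_eq_sub, ← sub_eq_add_neg]
  · dsimp only [Hexagon.Balanced]; omega
  · simp only [hP, Hexagon.mem_points]; omega
  · intro P hP' ht
    rw [hP, Hexagon.isTop_dominant hr hp hq hP' ht]
  · rw [← ncard_image_pt, image_pt_Wf hP]
    apply ncard_six
    simp only [List.nodup_cons, List.mem_cons, Prod.mk.injEq, List.not_mem_nil, List.nodup_nil,
      or_false, not_false_eq_true, and_true]
    omega

/-- From the hexagon of `z`, the sides bounding the two coordinates from below are pushed out by 3,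
the largest shift that `Balanced` allows; the result is symmetric under `s 0`. -/
theorem describes_opposite {z y : W} (hz : Dominant (pt z)) (hy : y = s 0 * z) :
    Describes {y, s 0 * y, s 1 * s 0 * y, s 2 * s 0 * y, s 0 * s 1 * s 0 * y,
      s 0 * s 2 * s 0 * y} y ∧
    ({y, s 0 * y, s 1 * s 0 * y, s 2 * s 0 * y, s 0 * s 1 * s 0 * y,
      s 0 * s 2 * s 0 * y} : Set W).ncard = 6 := by
  have hr := regular_pt z
  obtain ⟨⟨a, b⟩, hP⟩ : ∃ P, pt z = P := ⟨_, rfl⟩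
  rw [hP] at hz hr
  obtain ⟨hp, hq⟩ := hz
  simp only at hp hq
  have hV : pt '' {y, s 0 * y, s 1 * s 0 * y, s 2 * s 0 * y, s 0 * s 1 * s 0 * y,
      s 0 * s 2 * s 0 * y} = {(-b - 3, -a - 3), (a, b), (b - a, b), (a, a - b),
        (-b - 3, a - b - 3), (b - a - 3, -a - 3)} := by
    simp only [hy, mul_assoc, s_mul_s_mul, Set.image_insert_eq, Set.image_singleton, pt_s_mul, hP,
      gen_zero, gen_one, gen_two, neg_sub]
  have hyP : pt y = (-b - 3, -a - 3) := by rw [hy, pt_s_mul, hP, gen_zero]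
  refine ⟨⟨⟨-b - 3, a, -a - 3, b, -a, b⟩, ?_, ?_, Hexagon.le_iff_mem ?_ ?_ ?_⟩, ?_⟩
  · simp only [Hexagon.tight_iff, Hexagon.mem_points]; omega
  · rw [hV, Hexagon.vertices]
    simp only [show -a - 3 + b = b - a - 3 by ring, show -b - 3 - -a = a - b - 3 by ring,
      ← sub_eq_add_neg]
    ext P
    simp only [Set.mem_insert_iff, Set.mem_singleton_iff]
    tauto
  · dsimp only [Hexagon.Balanced]; omega
  · simp only [hyP, Hexagon.mem_points]; omega
  · intro P hP' ht
    rw [hyP, Hexagon.isTop_opposite hr hp hq hP' ht]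
  · rw [← ncard_image_pt, hV]
    apply ncard_six
    simp only [List.nodup_cons, List.mem_cons, Prod.mk.injEq, List.not_mem_nil, List.nodup_nil,
      or_false, not_false_eq_true, and_true]
    omega

theorem exists_pt_xElt {k : ℕ} (hk : 2 ≤ k) :
    ∃ a b : ℤ, pt (xElt k) = (a, b) ∧ 0 ≤ b ∧ (a = 2 * b + 1 ∨ a = 2 * b + 2) := by
  obtain ⟨j, rfl | rfl⟩ := k.even_or_odd'
  · exact ⟨_, _, pt_xElt_even j, by omega, by omega⟩
  · exact ⟨_, _, pt_xElt_odd j, by omega, by omega⟩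

/-- The sides belonging to `u₁` and `l₃` shrink to the points `(a, b)` and `(b - a, b)`, which
leaves four vertices. -/
theorem describes_strip {k : ℕ} (hk : 2 ≤ k) :
    Describes {xElt k, s 1 * xElt k, s 2 * s 1 * xElt k, s 1 * s 2 * s 1 * xElt k} (xElt k) ∧
    ({xElt k, s 1 * xElt k, s 2 * s 1 * xElt k, s 1 * s 2 * s 1 * xElt k} : Set W).ncard = 4 := by
  obtain ⟨a, b, hP, hb, hab⟩ := exists_pt_xElt hk
  have hV : pt '' {xElt k, s 1 * xElt k, s 2 * s 1 * xElt k, s 1 * s 2 * s 1 * xElt k} =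
      {(a, b), (b - a, b), (b - a, -a), (-b, -a)} := by
    simp only [mul_assoc, Set.image_insert_eq, Set.image_singleton, pt_s_mul, hP, gen_one, gen_two,
      show b - a - b = -a by ring, show -a - (b - a) = -b by ring]
  refine ⟨⟨⟨b - a, a, -a, b, -a, a - b⟩, ?_, ?_, Hexagon.le_iff_mem ?_ ?_ ?_⟩, ?_⟩
  · simp only [Hexagon.tight_iff, Hexagon.mem_points]; omega
  · rw [hV, Hexagon.vertices]
    simp only [show a - (a - b) = b by ring, show -a + (a - b) = -b by ring,
      show b - a - -a = b by ring, ← sub_eq_add_neg]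
    ext P
    simp only [Set.mem_insert_iff, Set.mem_singleton_iff]
    tauto
  · dsimp only [Hexagon.Balanced]; omega
  · simp only [hP, Hexagon.mem_points]; omega
  · intro P hP' ht
    rw [hP, Hexagon.isTop_strip hb hab hP' ht]
  · rw [← ncard_image_pt, hV]
    apply ncard_four
    simp only [List.nodup_cons, List.mem_cons, Prod.mk.injEq, List.not_mem_nil, List.nodup_nil,
      or_false, not_false_eq_true, and_true]
    omega

/-! ### Coordinates on the plane -/

theorem inner_α₂_α₁ : inner ℝ α₂ α₁ = (-1 : ℝ) := by rw [real_inner_comm, inner_α₁_α₂]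

/-- The coordinates on the plane in which the center of the alcove of `z` is `pt z`. -/
noncomputable def coord : E ≃ₗ[ℝ] ℝ × ℝ where
  toFun v := (2 * inner ℝ α₁ v + inner ℝ α₂ v, inner ℝ α₁ v + 2 * inner ℝ α₂ v)
  map_add' v w := by
    simp only [inner_add_right, Prod.mk_add_mk, Prod.mk.injEq]
    constructor <;> ring
  map_smul' c v := by
    simp only [real_inner_smul_right, RingHom.id_apply, Prod.smul_mk, smul_eq_mul, Prod.mk.injEq]
    constructor <;> ring
  invFun P := (P.1 / 3) • α₁ + (P.2 / 3) • α₂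
  left_inv v := by
    have q2 : √2 * √2 = (2 : ℝ) := Real.mul_self_sqrt (by norm_num)
    have q6 : √6 * √6 = (6 : ℝ) := Real.mul_self_sqrt (by norm_num)
    ext i
    dsimp only
    rw [inner_α₁, inner_α₂]
    fin_cases i <;> simp [α₁, α₂]
    · linear_combination (v 0) / 2 * q2
    · linear_combination (v 1) / 6 * q6
  right_inv P := by
    simp only [inner_add_right, real_inner_smul_right, inner_α₁_α₁, inner_α₁_α₂, inner_α₂_α₁,
      inner_α₂_α₂]
    ext <;> ring

theorem coord_apply (v : E) :
    coord v = (2 * inner ℝ α₁ v + inner ℝ α₂ v, inner ℝ α₁ v + 2 * inner ℝ α₂ v) := rfl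

/-- The real point with the given integral coordinates. -/
def realPt (P : ℤ × ℤ) : ℝ × ℝ := (P.1, P.2)

theorem realPt_injective : Function.Injective realPt := by
  rintro ⟨a, b⟩ ⟨c, d⟩ h
  simpa [realPt] using h

theorem cen_eq_action (z : W) : cen z = action z (cen 1) := by
  have h : ∀ w : W, cen w = action w (Finset.univ.centroid ℝ fundamentalVertex) := fun w =>
    (Finset.univ.map_affineCombination fundamentalVertex _
      (Finset.sum_centroidWeights_eq_one_of_nonempty ℝ _ Finset.univ_nonempty)
      (action w).toAffineEquiv.toAffineMap).symm
  rw [h z, h 1, map_one]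
  rfl

theorem cen_s_mul (i : ZMod 3) (z : W) : cen (s i * z) = simpleReflection i (cen z) := by
  rw [cen_eq_action, map_mul, action_s, cen_eq_action z]
  rfl

theorem coord_cen_one : coord (cen 1) = (-1, -1) := by
  have h : cen 1 = (3 : ℝ)⁻¹ • (-ϖ₁ - ϖ₂) := by
    rw [cen, Finset.centroid, Finset.affineCombination_eq_linear_combination _ _ _
      (Finset.sum_centroidWeights_eq_one_of_nonempty ℝ _ Finset.univ_nonempty)]
    simp only [Fin.sum_univ_three, Finset.centroidWeights_apply, Finset.card_univ, Fintype.card_fin,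
      alcoveVertex, map_one, fundamentalVertex, AffineIsometryEquiv.coe_one, id_eq,
      Matrix.cons_val_zero, Matrix.cons_val_one, Matrix.cons_val]
    push_cast
    module
  rw [h, coord_apply]
  simp only [ϖ₁, ϖ₂, inner_sub_right, inner_neg_right, inner_add_right, real_inner_smul_right,
    inner_α₁_α₁, inner_α₁_α₂, inner_α₂_α₁, inner_α₂_α₂, Prod.mk.injEq]
  norm_num

theorem coord_simpleReflection (i : ZMod 3) {v : E} {P : ℤ × ℤ} (h : coord v = realPt P) :
    coord (simpleReflection i v) = realPt (gen i P) := by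
  obtain ⟨a, b⟩ := P
  have h0 : inner ℝ ρ ρ = (2 : ℝ) := by
    simp only [ρ, inner_add_left, inner_add_right, inner_α₁_α₁, inner_α₁_α₂, inner_α₂_α₁,
      inner_α₂_α₂]
    norm_num
  have e0 : simpleReflection 0 = affineReflection ρ (-1) := rfl
  have e1 : simpleReflection 1 = affineReflection α₁ 0 := rfl
  have e2 : simpleReflection 2 = affineReflection α₂ 0 := rfl
  rw [coord_apply, realPt, Prod.mk.injEq] at h
  obtain ⟨h1, h2⟩ := h
  simp only at h1 h2
  rcases zmod_three_cases i with rfl | rfl | rfl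
  · rw [e0, affineReflection_apply _ _ h0, coord_apply, gen_zero, realPt, Prod.mk.injEq]
    simp only [ρ, inner_sub_right, inner_add_right, inner_add_left, real_inner_smul_right,
      inner_α₁_α₁, inner_α₁_α₂, inner_α₂_α₁, inner_α₂_α₂]
    push_cast
    constructor <;> linarith
  · rw [e1, affineReflection_apply _ _ inner_α₁_α₁, coord_apply, gen_one, realPt, Prod.mk.injEq]
    simp only [inner_sub_right, real_inner_smul_right, inner_α₁_α₁, inner_α₂_α₁]
    push_cast
    constructor <;> linarith
  · rw [e2, affineReflection_apply _ _ inner_α₂_α₂, coord_apply, gen_two, realPt, Prod.mk.injEq]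
    simp only [inner_sub_right, real_inner_smul_right, inner_α₂_α₂, inner_α₁_α₂]
    push_cast
    constructor <;> linarith

theorem coord_cen (z : W) : coord (cen z) = realPt (pt z) := by
  induction z using induction_left with
  | one => rw [coord_cen_one, pt_one]; simp [realPt]
  | mul i z h => rw [cen_s_mul, pt_s_mul, coord_simpleReflection i h]

theorem cen_injective : Function.Injective cen := by
  intro x y h
  apply pt_injective
  apply realPt_injective
  rw [← coord_cen, h, coord_cen]

/-! ### Real hexagons -/

theorem Convex.add_smul_mem_of_le {S : Set (ℝ × ℝ)} (hS : Convex ℝ S) {p v : ℝ × ℝ} {x y t : ℝ}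
    (hx : p + x • v ∈ S) (hy : p + y • v ∈ S) (hxt : x ≤ t) (hty : t ≤ y) : p + t • v ∈ S := by
  have ht : t ∈ segment ℝ x y := by
    rw [segment_eq_Icc (hxt.trans hty)]; exact ⟨hxt, hty⟩
  obtain ⟨a, b, ha, hb, hab, rfl⟩ := ht
  have := hS hx hy ha hb hab
  have e : a • (p + x • v) + b • (p + y • v) = (a + b) • p + (a • x + b • y) • v := by
    simp only [smul_eq_mul]; module
  rwa [e, hab, one_smul] at this

theorem Convex.horizontal_mem {S : Set (ℝ × ℝ)} (hS : Convex ℝ S) {x y t b : ℝ}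
    (hx : (x, b) ∈ S) (hy : (y, b) ∈ S) (hxt : x ≤ t) (hty : t ≤ y) : (t, b) ∈ S := by
  have e : ∀ r : ℝ, ((r, b) : ℝ × ℝ) = (0, b) + r • (1, 0) := fun r => by simp
  rw [e x] at hx; rw [e y] at hy; rw [e t]
  exact Convex.add_smul_mem_of_le hS hx hy hxt hty

theorem Convex.vertical_mem {S : Set (ℝ × ℝ)} (hS : Convex ℝ S) {x y t a : ℝ}
    (hx : (a, x) ∈ S) (hy : (a, y) ∈ S) (hxt : x ≤ t) (hty : t ≤ y) : (a, t) ∈ S := by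
  have e : ∀ r : ℝ, ((a, r) : ℝ × ℝ) = (a, 0) + r • (0, 1) := fun r => by simp
  rw [e x] at hx; rw [e y] at hy; rw [e t]
  exact Convex.add_smul_mem_of_le hS hx hy hxt hty

theorem Convex.diagonal_mem {S : Set (ℝ × ℝ)} (hS : Convex ℝ S) {x y t c : ℝ}
    (hx : (x + c, x) ∈ S) (hy : (y + c, y) ∈ S) (hxt : x ≤ t) (hty : t ≤ y) : (t + c, t) ∈ S := by
  have e : ∀ r : ℝ, ((r + c, r) : ℝ × ℝ) = (c, 0) + r • (1, 1) := fun r => by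
    simp [add_comm]
  rw [e x] at hx; rw [e y] at hy; rw [e t]
  exact Convex.add_smul_mem_of_le hS hx hy hxt hty

namespace Hexagon

/-- The real points of a hexagon. -/
def region (h : Hexagon) : Set (ℝ × ℝ) :=
  {P | (h.l₁ ≤ P.1 ∧ P.1 ≤ h.u₁) ∧ (h.l₂ ≤ P.2 ∧ P.2 ≤ h.u₂) ∧
    (h.l₃ ≤ P.1 - P.2 ∧ P.1 - P.2 ≤ h.u₃)}

theorem realPt_mem_region {h : Hexagon} {P : ℤ × ℤ} : realPt P ∈ h.region ↔ P ∈ h.points := by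
  simp only [region, points, realPt, Set.mem_ofPred_eq]
  norm_cast

theorem convex_region (h : Hexagon) : Convex ℝ h.region := by
  have h1 := (convex_Icc (h.l₁ : ℝ) h.u₁).linear_preimage (LinearMap.fst ℝ ℝ ℝ)
  have h2 := (convex_Icc (h.l₂ : ℝ) h.u₂).linear_preimage (LinearMap.snd ℝ ℝ ℝ)
  have h3 := (convex_Icc (h.l₃ : ℝ) h.u₃).linear_preimage
    (LinearMap.fst ℝ ℝ ℝ - LinearMap.snd ℝ ℝ ℝ)
  exact h1.inter (h2.inter h3)

/-- The horizontal line through a point of the region meets the boundary on both sides of it. Each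
end is on a vertical or a diagonal edge, depending on the height, hence in the hull of the vertices.
-/
theorem convexHull_vertices {h : Hexagon} (ht : h.Tight) :
    convexHull ℝ (realPt '' h.vertices) = h.region := by
  refine Set.Subset.antisymm (convexHull_min ?_ h.convex_region) ?_
  · rintro _ ⟨P, hP, rfl⟩
    exact realPt_mem_region.2 (ht hP)
  · rintro ⟨a, b⟩ ⟨⟨ha, ha'⟩, ⟨hb, hb'⟩, hd, hd'⟩
    simp only at ha ha' hb hb' hd hd'
    have hS := convex_convexHull ℝ (realPt '' h.vertices)
    have hv : ∀ P ∈ h.vertices, realPt P ∈ convexHull ℝ (realPt '' h.vertices) :=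
      fun P hP => subset_convexHull ℝ _ (Set.mem_image_of_mem _ hP)
    have v1 := hv (h.u₁, h.u₂) (by simp [vertices])
    have v2 := hv (h.u₁, h.u₁ - h.u₃) (by simp [vertices])
    have v3 := hv (h.l₂ + h.u₃, h.l₂) (by simp [vertices])
    have v4 := hv (h.l₁, h.l₂) (by simp [vertices])
    have v5 := hv (h.l₁, h.l₁ - h.l₃) (by simp [vertices])
    have v6 := hv (h.u₂ + h.l₃, h.u₂) (by simp [vertices])
    generalize convexHull ℝ (realPt '' h.vertices) = S at *
    simp only [realPt, Int.cast_sub, Int.cast_add] at v1 v2 v3 v4 v5 v6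
    have left : ∃ x ≤ a, (x, b) ∈ S := by
      rcases le_total ((h.l₁ : ℝ) - h.l₃) b with hl | hl
      · refine ⟨b + h.l₃, by linarith, Convex.diagonal_mem hS ?_ v6 hl hb'⟩
        rwa [sub_add_cancel]
      · exact ⟨h.l₁, ha, Convex.vertical_mem hS v4 v5 hb hl⟩
    have right : ∃ y, a ≤ y ∧ (y, b) ∈ S := by
      rcases le_total b ((h.u₁ : ℝ) - h.u₃) with hl | hl
      · refine ⟨b + h.u₃, by linarith, Convex.diagonal_mem hS v3 ?_ hb hl⟩
        rwa [sub_add_cancel]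
      · exact ⟨h.u₁, ha', Convex.vertical_mem hS v2 v1 hl hb'⟩
    obtain ⟨x, hxa, hx⟩ := left
    obtain ⟨y, hay, hy⟩ := right
    exact Convex.horizontal_mem hS hx hy hxa hay

theorem eq_of_combination_eq_upper {x y c a b : ℝ} (ha : 0 < a) (hb : 0 < b) (hab : a + b = 1)
    (hx : x ≤ c) (hy : y ≤ c) (h : a * x + b * y = c) : x = c ∧ y = c := by
  have hb' : b = 1 - a := by linarith
  subst hb'
  constructor <;> nlinarith

theorem eq_of_combination_eq_lower {x y c a b : ℝ} (ha : 0 < a) (hb : 0 < b) (hab : a + b = 1)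
    (hx : c ≤ x) (hy : c ≤ y) (h : a * x + b * y = c) : x = c ∧ y = c := by
  have := eq_of_combination_eq_upper (x := -x) (y := -y) (c := -c) ha hb hab (by linarith)
    (by linarith) (by linarith)
  constructor <;> linarith [this.1, this.2]

/-- A vertex attains two independent bounds. A bound attained in the interior of a segment of the
region is attained at both ends, and two such equations determine the ends. -/
theorem vertices_subset_extremePoints {h : Hexagon} (ht : h.Tight) :
    realPt '' h.vertices ⊆ Set.extremePoints ℝ h.region := by
  rintro _ ⟨P, hP, rfl⟩
  refine mem_extremePoints.2 ⟨realPt_mem_region.2 (ht hP), ?_⟩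
  rintro ⟨a, b⟩ ⟨⟨ha, ha'⟩, ⟨hb, hb'⟩, hd, hd'⟩ ⟨c, d⟩ ⟨⟨hc, hc'⟩, ⟨hd2, hd2'⟩, he, he'⟩
    ⟨r, t, hr, hs, hrs, heq⟩
  simp only [realPt, Prod.smul_mk, smul_eq_mul, Prod.mk_add_mk, Prod.mk.injEq] at *
  obtain ⟨e1, e2⟩ := heq
  have e3 : r * (a - b) + t * (c - d) = P.1 - P.2 := by linarith
  rcases hP with rfl | rfl | rfl | rfl | rfl | rfl <;> push_cast at e1 e2 e3 ⊢
  · have := eq_of_combination_eq_upper hr hs hrs ha' hc' e1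
    have := eq_of_combination_eq_upper hr hs hrs hb' hd2' e2
    tauto
  · have h1 := eq_of_combination_eq_upper hr hs hrs ha' hc' e1
    have h2 := eq_of_combination_eq_upper hr hs hrs hd' he' (by linarith)
    refine ⟨⟨h1.1, ?_⟩, h1.2, ?_⟩ <;> linarith [h1.1, h1.2, h2.1, h2.2]
  · have h1 := eq_of_combination_eq_lower hr hs hrs hb hd2 e2
    have h2 := eq_of_combination_eq_upper hr hs hrs hd' he' (by linarith)
    refine ⟨⟨?_, h1.1⟩, ?_, h1.2⟩ <;> linarith [h1.1, h1.2, h2.1, h2.2]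
  · have := eq_of_combination_eq_lower hr hs hrs ha hc e1
    have := eq_of_combination_eq_lower hr hs hrs hb hd2 e2
    tauto
  · have h1 := eq_of_combination_eq_lower hr hs hrs ha hc e1
    have h2 := eq_of_combination_eq_lower hr hs hrs hd he (by linarith)
    refine ⟨⟨h1.1, ?_⟩, h1.2, ?_⟩ <;> linarith [h1.1, h1.2, h2.1, h2.2]
  · have h1 := eq_of_combination_eq_upper hr hs hrs hb' hd2' e2
    have h2 := eq_of_combination_eq_lower hr hs hrs hd he (by linarith)
    refine ⟨⟨?_, h1.1⟩, ?_, h1.2⟩ <;> linarith [h1.1, h1.2, h2.1, h2.2]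

theorem finite_vertices (h : Hexagon) : h.vertices.Finite := by
  simp [vertices]

end Hexagon

/-! ### The polygon of an element -/

theorem coord_image_cen (V : Set W) : coord '' (cen '' V) = realPt '' (pt '' V) := by
  simp only [Set.image_image, coord_cen]

theorem coord_image_convexHull (V : Set W) :
    coord '' convexHull ℝ (cen '' V) = convexHull ℝ (realPt '' (pt '' V)) := by
  rw [← coord_image_cen]
  exact coord.toLinearMap.image_convexHull _

theorem Describes.le_iff {V : Set W} {y : W} (h : Describes V y) (x : W) :
    le x y ↔ cen x ∈ convexHull ℝ (cen '' V) := by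
  obtain ⟨h, ht, hV, hle⟩ := h
  rw [hle, ← Hexagon.realPt_mem_region, ← Hexagon.convexHull_vertices ht, ← hV,
    ← coord_image_convexHull, ← coord_cen, coord.injective.mem_set_image]

theorem Describes.le_of_mem {V : Set W} {y : W} (h : Describes V y) {v : W} (hv : v ∈ V) :
    le v y :=
  (h.le_iff v).2 (subset_convexHull ℝ _ (Set.mem_image_of_mem _ hv))

theorem Describes.finite {V : Set W} {y : W} (h : Describes V y) : V.Finite := by
  obtain ⟨h, _, hV, _⟩ := h
  exact Set.Finite.of_finite_image (hV ▸ h.finite_vertices) pt_injective.injOn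

theorem Describes.subset_extremePoints {V : Set W} {y : W} (h : Describes V y) :
    cen '' V ⊆ Set.extremePoints ℝ (convexHull ℝ (cen '' V)) := by
  obtain ⟨h, ht, hV, -⟩ := h
  rw [← Set.image_subset_image_iff coord.injective, image_extremePoints, coord_image_convexHull,
    coord_image_cen, hV, Hexagon.convexHull_vertices ht]
  exact Hexagon.vertices_subset_extremePoints ht

theorem isVertexSet_of_subset_extremePoints {V : Set E} (hV : V.Finite)
    (h : V ⊆ Set.extremePoints ℝ (convexHull ℝ V)) : IsVertexSet V (convexHull ℝ V) := by
  refine ⟨⟨hV, rfl⟩, fun A hA _ => ?_⟩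
  rw [← hA.2] at h
  exact h.trans extremePoints_convexHull_subset

theorem Describes.isVertexSet {V : Set W} {y : W} (h : Describes V y) :
    IsVertexSet (cen '' V) (convexHull ℝ (cen '' V)) :=
  isVertexSet_of_subset_extremePoints (h.finite.image _) h.subset_extremePoints

theorem Describes.convexHull_subset {V V' : Set W} {y : W} (h : Describes V y)
    (h' : Describes V' y) : convexHull ℝ (cen '' V') ⊆ convexHull ℝ (cen '' V) := by
  refine convexHull_min ?_ (convex_convexHull ℝ _)
  rintro _ ⟨v, hv, rfl⟩
  exact (h.le_iff v).1 (h'.le_of_mem hv)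

theorem Describes.subset {V V' : Set W} {y : W} (h : Describes V y) (h' : Describes V' y) :
    V ⊆ V' := by
  have e := Set.Subset.antisymm (h.convexHull_subset h') (h'.convexHull_subset h)
  have := h.subset_extremePoints
  rw [← e] at this
  exact (Set.image_subset_image_iff cen_injective).1 (this.trans extremePoints_convexHull_subset)

/-- The vertices are themselves alcove centers, so each hull contains the vertices of the other and
the hulls coincide. The extreme points of a hull lie in every set generating it. -/
theorem Describes.unique {V V' : Set W} {y : W} (h : Describes V y) (h' : Describes V' y) :
    V = V' :=
  Set.Subset.antisymm (h.subset h') (h'.subset h)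

theorem ncard_image_cen (V : Set W) : (cen '' V).ncard = V.ncard :=
  Set.ncard_image_of_injective V cen_injective

/-! ### Every element falls under one of the cases -/

theorem pow_δ_apply_pow_δ {i j : ℕ} (h : i + j = 3) (y : W) : (δ ^ i) ((δ ^ j) y) = y := by
  have h3 : δ ^ 3 = 1 := by rw [pow_succ, pow_two, δ_mul_δ_mul_δ]
  rw [← MulAut.mul_apply, ← pow_add, h, h3, MulAut.one_apply]

theorem pt_pow_δ (j : ℕ) (y : W) : pt ((δ ^ j) y) = rot^[j] (pt y) := by
  induction j with
  | zero => simp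
  | succ j ih => rw [pow_succ', MulAut.mul_apply, pt_δ, ih, Function.iterate_succ_apply']

/-- The point lies in the strip that contains the alcoves of the elements `x_k`. -/
def InStrip (P : ℤ × ℤ) : Prop := P.1 - 2 * P.2 = 1 ∨ P.1 - 2 * P.2 = 2

/-- Outside the three strips each root is positive or below -1. The six possible sign patterns are
the rotations of the dominant chamber and of its image under `s 0`. The condition `i + j = 3` makes
`δ ^ i` undo `δ ^ j`. -/
theorem exists_rot_iterate (P : ℤ × ℤ) (hP : Regular P) : ∃ i j : ℕ, i + j = 3 ∧
    (Dominant (rot^[j] P) ∨ Dominant (gen 0 (rot^[j] P)) ∨ InStrip (rot^[j] P)) := by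
  obtain ⟨a, b⟩ := P
  have h : (Dominant (a, b) ∨ Dominant (gen 0 (a, b)) ∨ InStrip (a, b)) ∨
      (Dominant (rot (a, b)) ∨ Dominant (gen 0 (rot (a, b))) ∨ InStrip (rot (a, b))) ∨
      (Dominant (rot (rot (a, b))) ∨ Dominant (gen 0 (rot (rot (a, b)))) ∨
        InStrip (rot (rot (a, b)))) := by
    simp only [Regular, Dominant, InStrip, rot, gen_zero] at *
    omega
  rcases h with h | h | h
  · exact ⟨3, 0, rfl, h⟩
  · exact ⟨2, 1, rfl, h⟩
  · exact ⟨1, 2, rfl, h⟩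

theorem exists_eq_xElt {y : W} (hy : InStrip (pt y)) (hb : -1 ≤ (pt y).2) : ∃ k, y = xElt k := by
  obtain ⟨⟨a, b⟩, hP⟩ : ∃ P, pt y = P := ⟨_, rfl⟩
  rw [hP] at hy hb
  simp only [InStrip] at hy hb
  obtain ⟨j, hj⟩ := Int.eq_ofNat_of_zero_le (show 0 ≤ b + 1 by omega)
  rcases hy with hy | hy
  · refine ⟨2 * j, pt_injective ?_⟩
    rw [hP, pt_xElt_even, Prod.mk.injEq]; omega
  · refine ⟨2 * j + 1, pt_injective ?_⟩
    rw [hP, pt_xElt_odd, Prod.mk.injEq]; omega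

theorem δ_mem : δ ∈ Subgroup.closure {δ, σ} := Subgroup.subset_closure (by simp)

theorem σ_mem : σ ∈ Subgroup.closure {δ, σ} := Subgroup.subset_closure (by simp)

/-- The `xElt k` fill one half of the strip. The automorphism `δ * σ` exchanges `s 0` and `s 1` and
fixes `s 2`; it maps the strip to itself and carries the other half into this one. -/
theorem exists_eq_map_xElt {y : W} (hy : InStrip (pt y)) :
    ∃ g ∈ Subgroup.closure {δ, σ}, ∃ k, y = g (xElt k) := by
  by_cases hb : -1 ≤ (pt y).2
  · obtain ⟨k, hk⟩ := exists_eq_xElt hy hb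
    exact ⟨1, Subgroup.one_mem _, k, hk⟩
  · have h : pt (δ (σ y)) = (-2 - (pt y).1, (pt y).2 - (pt y).1 - 1) := by
      rw [pt_δ, pt_σ]; rfl
    obtain ⟨k, hk⟩ := exists_eq_xElt (y := δ (σ y))
      (by rw [h]; simp only [InStrip] at *; omega)
      (by rw [h]; simp only [InStrip] at *; omega)
    refine ⟨(δ * σ)⁻¹, Subgroup.inv_mem _ (Subgroup.mul_mem _ δ_mem σ_mem), k, ?_⟩
    rw [← hk]
    exact ((δ * σ).symm_apply_apply y).symm

theorem exists_map_s {g : MulAut W} (hg : g ∈ Subgroup.closure {δ, σ}) (i : ZMod 3) :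
    ∃ j, g (s i) = s j := by
  induction hg using Subgroup.closure_induction_left with
  | one => exact ⟨i, rfl⟩
  | mul_left f hf g _ ih =>
    obtain ⟨j, hj⟩ := ih
    rw [MulAut.mul_apply, hj]
    rcases hf with rfl | rfl
    · exact ⟨_, δ_s j⟩
    · exact ⟨_, σ_s j⟩
  | inv_mul_cancel f hf g _ ih =>
    obtain ⟨j, hj⟩ := ih
    rw [MulAut.mul_apply, hj]
    rcases hf with rfl | rfl
    · exact ⟨j + 1 + 1, by rw [δ_inv, MulAut.mul_apply, δ_s, δ_s]⟩
    · exact ⟨_, by rw [σ_inv, σ_s]⟩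

theorem cases_of_elt (y : W) : y = 1 ∨ (∃ i : ZMod 3, y = s i) ∨
    (∃ i : ℕ, y ∈ (δ ^ i) '' D) ∨
    (∃ i : ℕ, y ∈ (δ ^ i) '' {u | ∃ z ∈ D, u = s 0 * z}) ∨
    (∃ g ∈ Subgroup.closure {δ, σ}, ∃ k : ℕ, 2 ≤ k ∧ y = g (xElt k)) := by
  obtain ⟨i, j, hij, h⟩ := exists_rot_iterate (pt y) (regular_pt y)
  rw [← pt_pow_δ] at h
  have hy := pow_δ_apply_pow_δ hij y
  rcases h with h | h | h
  · exact Or.inr (Or.inr (Or.inl ⟨i, _, mem_D_iff.2 h, hy⟩))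
  · refine Or.inr (Or.inr (Or.inr (Or.inl ⟨i, _, ⟨s 0 * (δ ^ j) y, ?_, ?_⟩, hy⟩)))
    · rw [mem_D_iff, pt_s_mul]; exact h
    · rw [s_mul_s_mul]
  · obtain ⟨g, hg, k, hk⟩ := exists_eq_map_xElt h
    have hg' : δ ^ i * g ∈ Subgroup.closure {δ, σ} :=
      Subgroup.mul_mem _ (Subgroup.pow_mem _ δ_mem i) hg
    have hy' : y = (δ ^ i * g) (xElt k) := by rw [MulAut.mul_apply, ← hk, hy]
    match k with
    | 0 => exact Or.inl (by rw [hy', xElt_zero, map_one])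
    | 1 =>
      obtain ⟨l, hl⟩ := exists_map_s hg' 1
      refine Or.inr (Or.inl ⟨l, ?_⟩)
      rw [hy', xElt_succ, xElt_zero, map_one, mul_one, hl]
    | k + 2 => exact Or.inr (Or.inr (Or.inr (Or.inr ⟨_, hg', k + 2, by omega, hy'⟩)))

/-! ### The polygons in the different cases -/

theorem describes_s (i : ZMod 3) : Describes {1, s i} (s i) := by
  have h := describes_s_one.map (Subgroup.pow_mem _ δ_mem (i - 1).val)
  rw [Set.image_pair, map_one, pow_δ_s, ZMod.natCast_val, ZMod.cast_id, add_sub_cancel] at h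
  exact h

theorem ncard_image_mulAut (g : MulAut W) (V : Set W) : (g '' V).ncard = V.ncard :=
  Set.ncard_image_of_injective V g.injective

theorem describes_of_mem_D {y : W} {i : ℕ} (hy : y ∈ (δ ^ i) '' D) :
    Describes {u | ∃ w ∈ Wf, u = (δ ^ i) w * y} y ∧
      {u | ∃ w ∈ Wf, u = (δ ^ i) w * y}.ncard = 6 := by
  obtain ⟨z, hz, rfl⟩ := hy
  obtain ⟨h, hc⟩ := describes_dominant (mem_D_iff.1 hz)
  have e : {u | ∃ w ∈ Wf, u = (δ ^ i) w * (δ ^ i) z} = (δ ^ i) '' {u | ∃ w ∈ Wf, u = w * z} := by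
    ext u
    constructor
    · rintro ⟨w, hw, rfl⟩
      exact ⟨w * z, ⟨w, hw, rfl⟩, map_mul _ _ _⟩
    · rintro ⟨_, ⟨w, hw, rfl⟩, rfl⟩
      exact ⟨w, hw, map_mul _ _ _⟩
  rw [e, ncard_image_mulAut]
  exact ⟨h.map (Subgroup.pow_mem _ δ_mem i), hc⟩

theorem describes_of_mem_s_mul_D {y : W} {i : ℕ}
    (hy : y ∈ (δ ^ i) '' {u | ∃ z ∈ D, u = s 0 * z}) :
    Describes {y, s i * y, s (1 + i) * s i * y, s (2 + i) * s i * y,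
      s i * s (1 + i) * s i * y, s i * s (2 + i) * s i * y} y ∧
    ({y, s i * y, s (1 + i) * s i * y, s (2 + i) * s i * y,
      s i * s (1 + i) * s i * y, s i * s (2 + i) * s i * y} : Set W).ncard = 6 := by
  obtain ⟨u, ⟨z, hz, hu⟩, rfl⟩ := hy
  obtain ⟨h, hc⟩ := describes_opposite (mem_D_iff.1 hz) hu
  have h' := h.map (Subgroup.pow_mem _ δ_mem i)
  rw [← ncard_image_mulAut (δ ^ i)] at hc
  simp only [Set.image_insert_eq, Set.image_singleton, map_mul, pow_δ_s, zero_add] at h' hc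
  exact ⟨h', hc⟩

theorem describes_map_xElt {g : MulAut W} (hg : g ∈ Subgroup.closure {δ, σ}) {k : ℕ}
    (hk : 2 ≤ k) :
    Describes (g '' {xElt k, s 1 * xElt k, s 2 * s 1 * xElt k, s 1 * s 2 * s 1 * xElt k})
      (g (xElt k)) ∧
    (g '' {xElt k, s 1 * xElt k, s 2 * s 1 * xElt k, s 1 * s 2 * s 1 * xElt k}).ncard = 4 := by
  obtain ⟨h, hc⟩ := describes_strip hk
  exact ⟨h.map hg, by rw [ncard_image_mulAut, hc]⟩

theorem exists_describes (y : W) : ∃ V, Describes V y := by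
  rcases cases_of_elt y with rfl | ⟨i, rfl⟩ | ⟨i, h⟩ | ⟨i, h⟩ | ⟨g, hg, k, hk, rfl⟩
  · exact ⟨_, describes_one⟩
  · exact ⟨_, describes_s i⟩
  · exact ⟨_, (describes_of_mem_D h).1⟩
  · exact ⟨_, (describes_of_mem_s_mul_D h).1⟩
  · exact ⟨_, (describes_map_xElt hg hk).1⟩

end AffineA2

theorem proposition2 (y : W) :
    -- every element of `W` is covered by one of the cases below
    (y = 1 ∨ (∃ i : ZMod 3, y = s i) ∨
      (∃ i : ℕ, y ∈ (δ ^ i) '' D) ∨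
      (∃ i : ℕ, y ∈ (δ ^ i) '' {u | ∃ z ∈ D, u = s 0 * z}) ∨
      (∃ g ∈ Subgroup.closure {δ, σ}, ∃ k : ℕ, 2 ≤ k ∧ y = g (xElt k))) ∧
    -- the polygon `C` of `y`, with the vertex set `cen '' V`, describes the lower interval of `y`
    ∃ (V : Set W) (C : Set E),
      IsVertexSet (cen '' V) C ∧
      (∀ x : W, le x y ↔ cen x ∈ C) ∧
      (y = 1 → V = {1}) ∧
      (∀ i : ZMod 3, y = s i → V = {1, s i}) ∧
      (∀ i : ℕ, y ∈ (δ ^ i) '' D →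
        V = {u | ∃ w ∈ Wf, u = (δ ^ i) w * y} ∧ (cen '' V).ncard = 6) ∧
      (∀ i : ℕ, y ∈ (δ ^ i) '' {u | ∃ z ∈ D, u = s 0 * z} →
        V = {y, s i * y, s (1 + i) * s i * y, s (2 + i) * s i * y,
          s i * s (1 + i) * s i * y, s i * s (2 + i) * s i * y} ∧
        (cen '' V).ncard = 6) ∧
      (∀ g ∈ Subgroup.closure {δ, σ}, ∀ k : ℕ, 2 ≤ k → y = g (xElt k) →
        V = g '' {xElt k, s 1 * xElt k, s 2 * s 1 * xElt k, s 1 * s 2 * s 1 * xElt k} ∧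
        (cen '' V).ncard = 4) := by
  refine ⟨cases_of_elt y, ?_⟩
  obtain ⟨V, hV⟩ := exists_describes y
  refine ⟨V, convexHull ℝ (cen '' V), hV.isVertexSet, hV.le_iff, ?_, ?_, ?_, ?_, ?_⟩
  · rintro rfl
    exact hV.unique describes_one
  · rintro i rfl
    exact hV.unique (describes_s i)
  · intro i h
    obtain ⟨h', hc⟩ := describes_of_mem_D h
    rw [ncard_image_cen, hV.unique h']
    exact ⟨rfl, hc⟩
  · intro i h
    obtain ⟨h', hc⟩ := describes_of_mem_s_mul_D h
    rw [ncard_image_cen, hV.unique h']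
    exact ⟨rfl, hc⟩
  · rintro g hg k hk rfl
    obtain ⟨h', hc⟩ := describes_map_xElt hg hk
    rw [ncard_image_cen, hV.unique h']
    exact ⟨rfl, hc⟩
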